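/- **Theorem (Stokes' Theorem for $\boldsymbol{D}_1$).** Let $m,k\ge 1$ be integers with $m+2k>4$. Let $\mathcal{C}l_m$ be the real Clifford algebra generated by $\mathbb{R}^m$ with $e_ie_j+e_je_i=-2\delta_{ij}$, let $\overline{\,\cdot\,}$ be Clifford conjugation (the linear anti-automorphism with $\overline{e_j}=-e_j$), and let $D_x=\sum_j e_j\partial_{x_j}$, $D_u=\sum_j e_j\partial_{u_j}$. Let $\mathcal{H}_k$ be the space of $\mathcal{C}l_m$-valued harmonic polynomials in $u\in\mathbb{R}^m$, homogeneous of degree $k$. Put $$P_k^+=I+\frac{uD_u}{m+2k-2},\qquad P_k^-=I-P_k^+ ,$$ the projections of the Almansi–Fischer decomposition $\mathcal{H}_k=\mathcal{M}_k\oplus u\mathcal{M}_{k-1}$, where $\mathcal{M}_k=\{p\in\mathcal{H}_k: D_up=0\}$. Let $R_k=P_k^+D_x$ and $T_k^*=P_k^-D_x$ (acting on $\mathcal{M}_k$-valued functions), $T_k=P_k^+D_x$ and $Q_k=P_k^-D_x$ (acting on $u\mathcal{M}_{k-1}$-valued functions), and $$\boldsymbol{D}_1=\begin{pmatrix} -R_kP_k^+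 & \dfrac{2T_k^*P_k^+}{\sqrt{(m+2k)(m+2k-4)}}\\ \dfrac{2T_kP_k^-}{m+2k-4} & \sqrt{\dfrac{m+2k}{m+2k-4}}\,Q_kP_k^-\end{pmatrix}.$$ Let $\Omega\subset\mathbb{R}^m$ be a bounded open set with $C^1$ boundary, outward unit normal $n(x)$ and area element $d\sigma(x)$ on $\partial\Omega$, and let $dS(u)$ be the area element on the unit sphere $\mathbb{S}^{m-1}$. Let $$\boldsymbol{d\sigma_x}=\begin{pmatrix}1&0\\0&-\sqrt{\frac{m+2k}{m+2k-4}}\end{pmatrix}n(x)\,d\sigma(x).$$ For $f,g\in C^\infty(\mathbb{R}^m,\mathcal{H}_k)$, written as vectors $\boldsymbol{f}=(P_k^+f,P_k^-f)^T$ and $\boldsymbol{g}=(P_k^+g,P_k^-g)^T$, $$\int_{\partial\Omega}\int_{\mathbb{S}^{m-1}}\overline{\boldsymbol{f}(x,u)}^T\,\boldsymbol{d\sigma_x}\,\boldsymbol{g}(x,u)\,dS(u)=\int_{\Omega}\int_{\mathbb{S}^{m-1}}\overline{\boldsymbol{D}_1\boldsymbol{f}(x,u)}^T\boldsymbol{g}(x,u)\,dS(u)\,dx-\int_{\Omega}\int_{\mathbb{S}^{m-1}}\overline{\boldsymbol{f}(x,u)}^T\,\boldsymbol{D}_1\boldsymbol{g}(x,u)\,dS(u)\,dx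 .$$ -/

import Mathlib

open MeasureTheory
open scoped ContDiff Matrix InnerProductSpace

namespace HigherSpin

/-- Euclidean space `ℝ^m`. -/
abbrev E (m : ℕ) : Type := EuclideanSpace ℝ (Fin m)

/-- The negative definite form `v ↦ -|v|²`. -/
noncomputable def cliffordForm (m : ℕ) : QuadraticForm ℝ (E m) :=
  -LinearMap.BilinMap.toQuadraticMap (innerₗ (E m))

/-- The real Clifford algebra `Cl_m`, with `e_i e_j + e_j e_i = -2 δ_ij`. Its `star` is the
Clifford conjugation, i.e. the anti-automorphism with `v ↦ -v` on vectors. -/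
abbrev Cl (m : ℕ) : Type := CliffordAlgebra (cliffordForm m)

/-- The embedding of vectors into the Clifford algebra. -/
noncomputable def vec {m : ℕ} (x : E m) : Cl m := CliffordAlgebra.ι (cliffordForm m) x

theorem finite_exteriorAlgebra (m : ℕ) : Module.Finite ℝ (ExteriorAlgebra ℝ (E m)) := by
  classical
  have hbot : ∀ n, m < n → (⋀[ℝ]^n (E m)) = ⊥ := by
    intro n hn
    apply Submodule.finrank_eq_zero.mp
    rw [exteriorPower.finrank_eq, finrank_euclideanSpace_fin]
    exact Nat.choose_eq_zero_of_lt hn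
  have htop : (⨆ n, ⋀[ℝ]^n (E m)) = ⊤ :=
    (DirectSum.Decomposition.isInternal (fun n : ℕ => ⋀[ℝ]^n (E m))).submodule_iSup_eq_top
  have hle : (⊤ : Submodule ℝ (ExteriorAlgebra ℝ (E m))) =
      (Finset.range (m + 1)).sup (fun n => ⋀[ℝ]^n (E m)) := by
    apply le_antisymm _ le_top
    rw [← htop]
    apply iSup_le
    intro n
    by_cases hn : m < n
    · rw [hbot n hn]; exact bot_le
    · exact Finset.le_sup (f := fun n => ⋀[ℝ]^n (E m)) (Finset.mem_range.mpr (by omega))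
  refine ⟨?_⟩
  rw [hle]
  exact Submodule.fg_finset_sup _ _ (fun n _ => Module.Finite.iff_fg.mp inferInstance)

instance finite_cl (m : ℕ) : Module.Finite ℝ (Cl m) :=
  haveI := finite_exteriorAlgebra m
  haveI : Invertible (2 : ℝ) := invertibleOfNonzero two_ne_zero
  Module.Finite.equiv (CliffordAlgebra.equivExterior (cliffordForm m)).symm

/-- Linear coordinates on the finite-dimensional algebra `Cl_m`. -/
noncomputable def clCoord (m : ℕ) :
    Cl m →ₗ[ℝ] EuclideanSpace ℝ (Fin (Module.finrank ℝ (Cl m))) :=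
  ((Module.finBasis ℝ (Cl m)).equivFun.trans (WithLp.linearEquiv 2 ℝ _).symm).toLinearMap

theorem clCoord_injective (m : ℕ) : Function.Injective (clCoord m) :=
  ((Module.finBasis ℝ (Cl m)).equivFun.trans (WithLp.linearEquiv 2 ℝ _).symm).injective

/-- A norm on the finite-dimensional space `Cl_m`. All norms are equivalent, so derivatives,
smoothness and integrals of `Cl_m`-valued functions do not depend on this choice. -/
noncomputable instance normedAddCommGroupCl (m : ℕ) : NormedAddCommGroup (Cl m) :=
  NormedAddCommGroup.induced (Cl m) _ (clCoord m) (clCoord_injective m)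

noncomputable instance normedSpaceCl (m : ℕ) : NormedSpace ℝ (Cl m) :=
  NormedSpace.induced ℝ (Cl m) _ (clCoord m)

/-- The Dirac operator `∑ⱼ eⱼ ∂ⱼ`. -/
noncomputable def dirac {m : ℕ} (F : E m → Cl m) (x : E m) : Cl m :=
  ∑ j : Fin m, vec (EuclideanSpace.single j (1 : ℝ)) *
    fderiv ℝ F x (EuclideanSpace.single j (1 : ℝ))

/-- `Cl_m`-valued polynomial functions on `ℝ^m`, homogeneous of degree `k`. -/
noncomputable def homPoly (m k : ℕ) : Submodule ℝ (E m → Cl m) :=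
  Submodule.span ℝ {p | ∃ q : MvPolynomial (Fin m) ℝ, q.IsHomogeneous k ∧
    ∃ a : Cl m, p = fun u => MvPolynomial.eval (fun i => u i) q • a}

/-- The space `ℋ_k` of `Cl_m`-valued harmonic polynomials homogeneous of degree `k`. -/
def harmPoly (m k : ℕ) : Set (E m → Cl m) :=
  {p | p ∈ homPoly m k ∧ ∀ u, Laplacian.laplacian p u = 0}

/-- Functions `f(x,u)` of two vector variables with values in `Cl_m`. -/
abbrev Field (m : ℕ) : Type := E m → E m → Cl m

/-- `f ∈ C^∞(ℝ^m, ℋ_k)`. -/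
def IsSmoothHarm {m : ℕ} (k : ℕ) (f : Field m) : Prop :=
  ContDiff ℝ ∞ (fun z : E m × E m => f z.1 z.2) ∧ ∀ x, f x ∈ harmPoly m k

/-- The Dirac operator in the variable `x`. -/
noncomputable def diracX {m : ℕ} (f : Field m) : Field m :=
  fun x u => dirac (fun y => f y u) x

/-- `P_k^+ = I + u D_u / (m + 2k - 2)`. -/
noncomputable def Pplus {m : ℕ} (k : ℕ) (f : Field m) : Field m :=
  fun x u => f x u + ((m : ℝ) + 2 * k - 2)⁻¹ • (vec u * dirac (f x) u)

/-- `P_k^- = I - P_k^+`. -/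
noncomputable def Pminus {m : ℕ} (k : ℕ) (f : Field m) : Field m :=
  fun x u => f x u - Pplus k f x u

/-- The Rarita-Schwinger operator `R_k = P_k^+ D_x` (on `ℳ_k`-valued functions). -/
noncomputable def opR {m : ℕ} (k : ℕ) (f : Field m) : Field m := Pplus k (diracX f)

/-- The twistor operator `T_k = P_k^+ D_x` (on `u ℳ_{k-1}`-valued functions). -/
noncomputable def opT {m : ℕ} (k : ℕ) (f : Field m) : Field m := Pplus k (diracX f)

/-- The dual twistor operator `T_k^* = P_k^- D_x` (on `ℳ_k`-valued functions). -/
noncomputable def opTdual {m : ℕ} (k : ℕ) (f : Field m) : Field m := Pminus k (diracX f)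

/-- The remaining operator `Q_k = P_k^- D_x` (on `u ℳ_{k-1}`-valued functions). -/
noncomputable def opQ {m : ℕ} (k : ℕ) (f : Field m) : Field m := Pminus k (diracX f)

/-- The vector `(f₁, f₂)ᵀ = (P_k^+ f, P_k^- f)ᵀ` of the components of `f` in the Almansi-Fischer
decomposition `ℋ_k = ℳ_k ⊕ u ℳ_{k-1}`. -/
noncomputable def almansi {m : ℕ} (k : ℕ) (f : Field m) : Fin 2 → Field m :=
  ![Pplus k f, Pminus k f]

/-- The `2 × 2` matrix `𝑫₁` of operators. -/
noncomputable def matD1 (m k : ℕ) : Matrix (Fin 2) (Fin 2) (Field m → Field m) :=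
  !![fun h => -opR k (Pplus k h),
     fun h => (2 / √(((m : ℝ) + 2 * k) * ((m : ℝ) + 2 * k - 4))) • opTdual k (Pplus k h);
     fun h => (2 / ((m : ℝ) + 2 * k - 4)) • opT k (Pminus k h),
     fun h => √(((m : ℝ) + 2 * k) / ((m : ℝ) + 2 * k - 4)) • opQ k (Pminus k h)]

/-- The action of `𝑫₁` on a vector of functions. -/
noncomputable def D1 {m : ℕ} (k : ℕ) (F : Fin 2 → Field m) : Fin 2 → Field m :=
  fun i => ∑ j, matD1 m k i j (F j)

/-- The value of a vector of functions at the point `(x,u)`. -/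
def at2 {m : ℕ} (F : Fin 2 → Field m) (x u : E m) : Fin 2 → Cl m := fun i => F i x u

/-- `ρ` is a `C¹` function near `p` with non-zero gradient at `p`, and `Ω` is the set
`{ρ < 0}` near `p`. -/
def IsDefiningFunction {m : ℕ} (Ω : Set (E m)) (p : E m) (ρ : E m → ℝ) : Prop :=
  ∃ U : Set (E m), IsOpen U ∧ p ∈ U ∧ ContDiffOn ℝ 1 ρ U ∧ (∀ x ∈ U, x ∈ Ω ↔ ρ x < 0) ∧
    gradient ρ p ≠ 0

/-- `Ω` has a `C¹` boundary. -/
def HasC1Boundary {m : ℕ} (Ω : Set (E m)) : Prop :=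
  ∀ p ∈ frontier Ω, ∃ ρ, IsDefiningFunction Ω p ρ

open Classical in
/-- The outward unit normal `∇ρ / |∇ρ|` at a boundary point, where `ρ` is any local defining
function (the value does not depend on its choice). -/
noncomputable def outwardNormal {m : ℕ} (Ω : Set (E m)) (p : E m) : E m :=
  if h : ∃ ρ, IsDefiningFunction Ω p ρ then
    ‖gradient h.choose p‖⁻¹ • gradient h.choose p
  else 0

/-- The matrix `diag(1, -√((m+2k)/(m+2k-4))) n(x)`, the density of `𝒅𝝈ₓ` with respect to the
area element `dσ(x)`. -/
noncomputable def sigmaMatrix {m : ℕ} (k : ℕ) (Ω : Set (E m)) (x : E m) :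
    Matrix (Fin 2) (Fin 2) (Cl m) :=
  !![vec (outwardNormal Ω x), 0;
     0, (-√(((m : ℝ) + 2 * k) / ((m : ℝ) + 2 * k - 4))) • vec (outwardNormal Ω x)]

/-- The area measure `dS` on the unit sphere `𝕊^{m-1}`. -/
noncomputable def sphereArea (m : ℕ) : Measure (Metric.sphere (0 : E m) 1) :=
  (volume : Measure (E m)).toSphere

/-- The area measure `dσ` on `∂Ω`: the Euclidean `(m-1)`-dimensional Hausdorff measure. -/
noncomputable def boundaryArea {m : ℕ} (Ω : Set (E m)) : Measure (E m) :=
  (μHE[m - 1] : Measure (E m)).restrict (frontier Ω)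

end HigherSpin

/-! ### Integration along slanted lines over a hyperplane. -/

section SlantedCoordinates

open Set Filter Topology

variable {V : Type*} [NormedAddCommGroup V] [InnerProductSpace ℝ V] [FiniteDimensional ℝ V]
  [MeasurableSpace V] [BorelSpace V]

/-! Since P⁺P⁻ = P⁻P⁺ = 0 on ℋ_k, the off-diagonal entries of 𝑫₁ vanish on Almansi components, so
𝑫₁(f⁺, f⁻) = (-P⁺D_x f⁺, s P⁻D_x f⁻) with s = √((m+2k)/(m+2k-4)) (`at2_D1_almansi`). The operator
D_x preserves ℋ_k, and ℳ_k is orthogonal to uℳ_{k-1} on the sphere. Hence the outer projections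
disappear after pairing with a component of the same type and integrating over u. What remains is,
for each fixed u, a combination with weights 1 and -s of Stokes' theorem for the Dirac operator,
∫_∂Ω ā n b = ∫_Ω (ā Db - (Da)‾ b). Fubini moves the u-integral outside to use it.

Dirac Stokes is the divergence theorem applied to the fields ā e_j b, the sign coming from
conjugation of e_j. The divergence theorem on a C¹ domain, with Hausdorff measure on the boundary,
is proved without the area formula. Near a boundary point with normal n, and for ⟨n,v⟩ > 0, the
fundamental theorem of calculus on lines of direction v expresses ∫_Ω ∂_v G exactly as ⟨n,v⟩ times
the integral of G against the pullback of Lebesgue measure under the projection of the boundary to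
n^⊥ along v. On a small patch this projection is nearly an isometry, so the pullback is close to
surface measure and the error is at most ε∫|G| (`exists_ball_setIntegral_fderiv_near`). A partition
of unity adds these errors to ε∫|G| again, and ε is arbitrary
(`setIntegral_fderiv_eq_integral_boundaryArea`).

The spherical orthogonality (`IsMonogenic.integral_sphere_star_mul_vec_mul`) comes from integrating
Σ_j ∂_j(p̄ e_j q) = 0 by parts against exp(-|x|²): the gradient of the Gaussian yields ∫ exp(-|x|²)
p̄ x q = 0, and homogeneity with polar coordinates leaves the sphere integral times a positive
factor. -/

theorem measurePreserving_smul_add_orthogonal {n : V} (hn : ‖n‖ = 1) :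
    MeasurePreserving (fun q : ℝ × (ℝ ∙ n)ᗮ => q.1 • n + (q.2 : V))
      (volume.prod volume) volume := by
  have h1 := ((ℝ ∙ n).measurePreserving_measurableEquivProd (0 : V)).symm
  rw [InnerProductSpace.euclideanHausdorffMeasure_eq_volume] at h1
  have h2 := (LinearIsometryEquiv.toSpanUnitSingleton (𝕜 := ℝ) n hn).measurePreserving
  have h3 := h1.comp (h2.prod (MeasurePreserving.id (volume : Measure (ℝ ∙ n)ᗮ)))
  have h4 : (fun q : ℝ × (ℝ ∙ n)ᗮ => q.1 • n + (q.2 : V)) =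
      ⇑((ℝ ∙ n).measurableEquivProd (0 : V)).symm ∘
        Prod.map (LinearIsometryEquiv.toSpanUnitSingleton (𝕜 := ℝ) n hn) id := by
    funext q
    simp
  rw [h4]
  exact h3

/-- Write v = c n + w with c = ⟨n,v⟩ and w ∈ n^⊥. Then t v + y = (c t) n + (y + t w): a scaling of t
by c combined with a measure-preserving shear. -/
theorem map_smul_add_orthogonal {n v : V} (hn : ‖n‖ = 1) (hc : 0 < ⟪n, v⟫_ℝ) :
    Measure.map (fun q : ℝ × (ℝ ∙ n)ᗮ => q.1 • v + (q.2 : V)) (volume.prod volume) =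
      ENNReal.ofReal (⟪n, v⟫_ℝ)⁻¹ • volume := by
  set c := ⟪n, v⟫_ℝ with hc_def
  have hw : v - c • n ∈ (ℝ ∙ n)ᗮ := by
    rw [Submodule.mem_orthogonal_singleton_iff_inner_right, inner_sub_right, inner_smul_right,
      real_inner_self_eq_norm_sq, hn]
    simp [hc_def]
  set w : (ℝ ∙ n)ᗮ := ⟨v - c • n, hw⟩ with hw_def
  have h1 : MeasurePreserving (fun t : ℝ => c * t) volume (ENNReal.ofReal c⁻¹ • volume) := by
    refine ⟨by fun_prop, ?_⟩
    rw [Real.map_volume_mul_left hc.ne', abs_of_pos (inv_pos.2 hc)]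
  have h2 : MeasurePreserving (fun q : ℝ × (ℝ ∙ n)ᗮ => (c * q.1, q.2 + q.1 • w))
      (volume.prod volume) ((ENNReal.ofReal c⁻¹ • volume).prod volume) := by
    refine h1.skew_product (g := fun t y => y + t • w) ?_ ?_
    · exact (by fun_prop : Continuous fun q : ℝ × (ℝ ∙ n)ᗮ => q.2 + q.1 • w).measurable
    · exact Eventually.of_forall fun t => map_add_right_eq_self _ _
  have h3 := measurePreserving_smul_add_orthogonal (V := V) hn
  have h4 : (fun q : ℝ × (ℝ ∙ n)ᗮ => q.1 • v + (q.2 : V)) =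
      (fun q : ℝ × (ℝ ∙ n)ᗮ => q.1 • n + (q.2 : V)) ∘
        (fun q : ℝ × (ℝ ∙ n)ᗮ => (c * q.1, q.2 + q.1 • w)) := by
    funext q
    simp only [Function.comp_apply, hw_def, Submodule.coe_add, Submodule.coe_smul]
    module
  rw [h4, ← Measure.map_map h3.measurable h2.measurable, h2.map_eq, Measure.prod_smul_left,
    Measure.map_smul, h3.map_eq]

/-- Integration along lines of direction `v`, parametrized by the hyperplane `n^⊥`. -/
theorem integral_eq_inner_mul_integral_integral {n v : V} (hn : ‖n‖ = 1) (hc : 0 < ⟪n, v⟫_ℝ)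
    {F : V → ℝ} (hF : Integrable F) :
    ∫ x, F x = ⟪n, v⟫_ℝ * ∫ y : (ℝ ∙ n)ᗮ, ∫ t : ℝ, F (t • v + (y : V)) := by
  have hm : Measurable (fun q : ℝ × (ℝ ∙ n)ᗮ => q.1 • v + (q.2 : V)) :=
    (by fun_prop : Continuous fun q : ℝ × (ℝ ∙ n)ᗮ => q.1 • v + (q.2 : V)).measurable
  have h := map_smul_add_orthogonal hn hc
  have hF' : Integrable F (Measure.map (fun q : ℝ × (ℝ ∙ n)ᗮ => q.1 • v + (q.2 : V))
      (volume.prod volume)) := by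
    rw [h]; exact hF.smul_measure ENNReal.ofReal_ne_top
  have h5 := integral_map hm.aemeasurable hF'.aestronglyMeasurable
  rw [h, integral_smul_measure, ENNReal.toReal_ofReal (inv_nonneg.2 hc.le)] at h5
  have h6 := hF'.comp_measurable hm
  rw [← integral_prod_symm (fun q : ℝ × (ℝ ∙ n)ᗮ => F (q.1 • v + (q.2 : V))) h6, ← h5,
    smul_eq_mul, mul_inv_cancel_left₀ hc.ne']

end SlantedCoordinates

/-! ### The fundamental theorem of calculus on one line. -/

section Fibre

open Set Filter Topology

/-- Where `g'` is nonzero, monotonicity of `h` makes `S` coincide with the half-line t < t₀; compact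
support removes the term at -∞. -/
theorem setIntegral_deriv_of_zero {g g' h : ℝ → ℝ} {S I : Set ℝ} (hS : MeasurableSet S) {t₀ : ℝ}
    (hg : ∀ t, HasDerivAt g (g' t) t) (hg' : Continuous g') (hgs : HasCompactSupport g)
    (hI : ∀ t, g' t ≠ 0 → t ∈ I) (hmono : StrictMonoOn h I) (hSI : ∀ t ∈ I, t ∈ S ↔ h t < 0)
    (ht₀ : t₀ ∈ I) (h0 : h t₀ = 0) :
    ∫ t in S, g' t = g t₀ := by
  have hg'' : g' = deriv g := funext fun t => (hg t).deriv.symm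
  have hint : Integrable g' := hg'.integrable_of_hasCompactSupport (hg'' ▸ hgs.deriv)
  have h1 : ∫ t in Iic t₀, g' t = g t₀ := by
    have := integral_Iic_of_hasDerivAt_of_tendsto (f := g) (f' := g') (a := t₀) (m := 0)
      (hg t₀).continuousAt.continuousWithinAt (fun x _ => hg x) hint.integrableOn
      (hgs.is_zero_at_infty.mono_left atBot_le_cocompact)
    simpa using this
  rw [← h1, integral_Iic_eq_integral_Iio, ← integral_indicator hS,
    ← integral_indicator measurableSet_Iio]
  congr 1
  funext t
  by_cases ht : g' t = 0
  · simp [indicator, ht]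
  · have htI := hI t ht
    have : t ∈ S ↔ t ∈ Iio t₀ := by
      rw [hSI t htI, ← h0, mem_Iio, hmono.lt_iff_lt htI ht₀]
    simp [indicator, this]

/-- By the intermediate value theorem `h` has one sign on `I`, so `S` contains all of `I` or none of
it; the derivative of a compactly supported function has total integral zero. -/
theorem setIntegral_deriv_of_no_zero {g g' h : ℝ → ℝ} {S I : Set ℝ} (hS : MeasurableSet S)
    (hg : ∀ t, HasDerivAt g (g' t) t) (hg' : Continuous g') (hgs : HasCompactSupport g)
    (hI : ∀ t, g' t ≠ 0 → t ∈ I) (hIc : IsPreconnected I) (hcont : ContinuousOn h I)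
    (hSI : ∀ t ∈ I, t ∈ S ↔ h t < 0) (h0 : ∀ t ∈ I, h t ≠ 0) :
    ∫ t in S, g' t = 0 := by
  have hg'' : g' = deriv g := funext fun t => (hg t).deriv.symm
  have hint : Integrable g' := hg'.integrable_of_hasCompactSupport (hg'' ▸ hgs.deriv)
  by_cases hneg : ∃ a ∈ I, h a < 0
  · obtain ⟨a, ha, hla⟩ := hneg
    have hall : ∀ t ∈ I, h t < 0 := by
      intro t ht
      by_contra hcon
      obtain ⟨s, hs, hs0⟩ := hIc.intermediate_value ha ht hcont
        (show (0 : ℝ) ∈ Icc (h a) (h t) from ⟨hla.le, not_lt.1 hcon⟩)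
      exact h0 s hs hs0
    have h1 : ∫ t, g' t = 0 := by
      have := integral_of_hasDerivAt_of_tendsto (f := g) (f' := g') (m := 0) (n := 0)
        hg hint (hgs.is_zero_at_infty.mono_left atBot_le_cocompact)
        (hgs.is_zero_at_infty.mono_left atTop_le_cocompact)
      simpa using this
    rw [← h1]
    refine setIntegral_eq_integral_of_forall_compl_eq_zero fun t ht => ?_
    by_contra hcon
    exact ht ((hSI t (hI t hcon)).2 (hall t (hI t hcon)))
  · push Not at hneg
    rw [← integral_indicator hS]
    refine integral_eq_zero_of_ae (Eventually.of_forall fun t => ?_)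
    by_cases ht : g' t = 0
    · simp [indicator, ht]
    · have htI := hI t ht
      have : t ∉ S := fun hts => absurd ((hSI t htI).1 hts) (not_lt.2 (hneg t htI))
      simp [indicator, this]

end Fibre

/-! ### Comparison of Hausdorff measures under almost isometries. -/

section MeasureComparison

open Set Filter Topology

/-- Measure inequalities compare integrals of nonnegative functions only, so positive and negative
parts are treated separately and their errors added. -/
theorem abs_integral_sub_integral_le_of_measure_le {X : Type*} [MeasurableSpace X]
    {μ ν : Measure X} {ε : ℝ} (hε0 : 0 ≤ ε) (hε1 : ε ≤ 1)
    (hle : ν ≤ ENNReal.ofReal (1 + ε) • μ) (hge : ENNReal.ofReal (1 - ε) • μ ≤ ν)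
    {G : X → ℝ} (hG : Integrable G μ) :
    |∫ x, G x ∂ν - ∫ x, G x ∂μ| ≤ ε * ∫ x, |G x| ∂μ := by
  have key : ∀ P : X → ℝ, Integrable P μ → (∀ x, 0 ≤ P x) →
      ∫ x, P x ∂ν ≤ (1 + ε) * ∫ x, P x ∂μ ∧ (1 - ε) * ∫ x, P x ∂μ ≤ ∫ x, P x ∂ν := by
    intro P hP hP0
    have hP1 : Integrable P (ENNReal.ofReal (1 + ε) • μ) := hP.smul_measure ENNReal.ofReal_ne_top
    have hP2 : Integrable P ν := hP1.mono_measure hle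
    constructor
    · have := integral_mono_measure hle (Eventually.of_forall hP0) hP1
      rwa [integral_smul_measure, ENNReal.toReal_ofReal (by linarith), smul_eq_mul] at this
    · have := integral_mono_measure hge (Eventually.of_forall hP0) hP2
      rwa [integral_smul_measure, ENNReal.toReal_ofReal (by linarith), smul_eq_mul] at this
  have hGν : Integrable G ν := (hG.smul_measure ENNReal.ofReal_ne_top).mono_measure hle
  obtain ⟨p1, p2⟩ := key (fun x => max (G x) 0) hG.pos_part fun x => le_max_right _ _
  obtain ⟨n1, n2⟩ := key (fun x => max (-G x) 0) hG.neg_part fun x => le_max_right _ _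
  have e1 : ∀ x, G x = max (G x) 0 - max (-G x) 0 := fun x => by
    rcases le_total (G x) 0 with h | h
    · rw [max_eq_right h, max_eq_left (by linarith)]; ring
    · rw [max_eq_left h, max_eq_right (by linarith)]; ring
  have e2 : ∀ x, |G x| = max (G x) 0 + max (-G x) 0 := fun x => by
    rcases le_total (G x) 0 with h | h
    · rw [max_eq_right h, max_eq_left (by linarith), abs_of_nonpos h]; ring
    · rw [max_eq_left h, max_eq_right (by linarith), abs_of_nonneg h]; ring
  have a1 : ∫ x, G x ∂μ = ∫ x, max (G x) 0 ∂μ - ∫ x, max (-G x) 0 ∂μ := by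
    rw [← integral_sub hG.pos_part hG.neg_part]; exact integral_congr_ae (.of_forall e1)
  have a2 : ∫ x, G x ∂ν = ∫ x, max (G x) 0 ∂ν - ∫ x, max (-G x) 0 ∂ν := by
    rw [← integral_sub hGν.pos_part hGν.neg_part]; exact integral_congr_ae (.of_forall e1)
  have a3 : ∫ x, |G x| ∂μ = ∫ x, max (G x) 0 ∂μ + ∫ x, max (-G x) 0 ∂μ := by
    rw [← integral_add hG.pos_part hG.neg_part]; exact integral_congr_ae (.of_forall e2)
  rw [a1, a2, a3, abs_le]
  constructor <;> linarith

theorem euclideanHausdorffMeasure_le_of_antilipschitz {X Y : Type*}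
    [EMetricSpace X] [MeasurableSpace X] [BorelSpace X]
    [EMetricSpace Y] [MeasurableSpace Y] [BorelSpace Y] {f : X → Y} {K : NNReal}
    (hf : AntilipschitzWith K f) (d : ℕ) (s : Set X) :
    (μHE[d] : Measure X) s ≤ (K : ENNReal) ^ d * (μHE[d] : Measure Y) (f '' s) := by
  have h := hf.le_hausdorffMeasure_image (d := d) (by positivity) s
  simp only [Measure.euclideanHausdorffMeasure_def, Measure.smul_apply,
    Measure.nnreal_smul_coe_apply]
  rw [mul_left_comm]
  gcongr
  simpa using h

theorem euclideanHausdorffMeasure_image_le_of_lipschitz {X Y : Type*}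
    [EMetricSpace X] [MeasurableSpace X] [BorelSpace X]
    [EMetricSpace Y] [MeasurableSpace Y] [BorelSpace Y] {f : X → Y} {K : NNReal}
    (hf : LipschitzWith K f) (d : ℕ) (s : Set X) :
    (μHE[d] : Measure Y) (f '' s) ≤ (K : ENNReal) ^ d * (μHE[d] : Measure X) s := by
  have h := hf.hausdorffMeasure_image_le (d := d) (by positivity) s
  simp only [Measure.euclideanHausdorffMeasure_def, Measure.smul_apply,
    Measure.nnreal_smul_coe_apply]
  rw [mul_left_comm]
  gcongr
  simpa using h

/-- A bi-Lipschitz map with constants 1 ± η distorts d-dimensional measure by factors (1 ± η)^d;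
this chooses η for a prescribed distortion ε. -/
theorem exists_pow_near_one (d : ℕ) {ε : ℝ} (hε : 0 < ε) :
    ∃ η : ℝ, 0 < η ∧ η < 1 ∧ (1 + η) ^ d ≤ 1 + ε ∧ 1 - ε ≤ (1 - η) ^ d := by
  have h1 : Tendsto (fun η : ℝ => (1 + η) ^ d) (𝓝[>] 0) (𝓝 1) := by
    have : Continuous fun η : ℝ => (1 + η) ^ d := by fun_prop
    simpa using (this.tendsto 0).mono_left (nhdsWithin_le_nhds (s := Ioi 0))
  have h2 : Tendsto (fun η : ℝ => (1 - η) ^ d) (𝓝[>] 0) (𝓝 1) := by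
    have : Continuous fun η : ℝ => (1 - η) ^ d := by fun_prop
    simpa using (this.tendsto 0).mono_left (nhdsWithin_le_nhds (s := Ioi 0))
  have h3 := h1.eventually (Iic_mem_nhds (show (1 : ℝ) < 1 + ε by linarith))
  have h4 := h2.eventually (Ici_mem_nhds (show 1 - ε < (1 : ℝ) by linarith))
  have h5 : ∀ᶠ η : ℝ in 𝓝[>] 0, η ∈ Ioo (0 : ℝ) 1 := Ioo_mem_nhdsGT one_pos
  obtain ⟨η, a, b, c⟩ := (h3.and (h4.and h5)).exists
  exact ⟨η, c.1, c.2, a, b⟩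

/-- A map which is nearly an isometry nearly preserves the Euclidean Hausdorff measure. -/
theorem euclideanHausdorffMeasure_comap_bounds {X Y : Type*}
    [MetricSpace X] [MeasurableSpace X] [BorelSpace X]
    [MetricSpace Y] [MeasurableSpace Y] [BorelSpace Y] {f : X → Y}
    (hfe : MeasurableEmbedding f) {d : ℕ} {η ε : ℝ} (hη0 : 0 < η) (hη1 : η < 1)
    (hup : (1 + η) ^ d ≤ 1 + ε) (hlo : 1 - ε ≤ (1 - η) ^ d)
    (hf1 : ∀ x y, dist (f x) (f y) ≤ (1 + η) * dist x y)
    (hf2 : ∀ x y, (1 - η) * dist x y ≤ dist (f x) (f y)) :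
    Measure.comap f μHE[d] ≤ ENNReal.ofReal (1 + ε) • (μHE[d] : Measure X) ∧
      ENNReal.ofReal (1 - ε) • (μHE[d] : Measure X) ≤ Measure.comap f μHE[d] := by
  have hL : LipschitzWith (1 + η).toNNReal f := LipschitzWith.of_dist_le_mul fun x y => by
    rw [Real.coe_toNNReal _ (by linarith)]; exact hf1 x y
  have hA : AntilipschitzWith ((1 - η)⁻¹).toNNReal f :=
    AntilipschitzWith.of_le_mul_dist fun x y => by
      have h0 : 0 < 1 - η := by linarith
      rw [Real.coe_toNNReal _ (inv_nonneg.2 h0.le), inv_mul_eq_div, le_div_iff₀ h0, mul_comm]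
      exact hf2 x y
  constructor
  · refine Measure.le_intro fun s hs _ => ?_
    rw [hfe.comap_apply, Measure.smul_apply, smul_eq_mul]
    refine (euclideanHausdorffMeasure_image_le_of_lipschitz hL d s).trans ?_
    gcongr
    change ENNReal.ofReal (1 + η) ^ d ≤ _
    rw [← ENNReal.ofReal_pow (by linarith)]
    exact ENNReal.ofReal_le_ofReal hup
  · refine Measure.le_intro fun s hs _ => ?_
    rw [hfe.comap_apply, Measure.smul_apply, smul_eq_mul]
    have h1 := euclideanHausdorffMeasure_le_of_antilipschitz hA d s
    have h0 : 0 < 1 - η := by linarith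
    calc ENNReal.ofReal (1 - ε) * (μHE[d] : Measure X) s
        ≤ ENNReal.ofReal ((1 - η) ^ d) *
          (((1 - η)⁻¹.toNNReal : ENNReal) ^ d * (μHE[d] : Measure Y) (f '' s)) := by
          gcongr
      _ = (μHE[d] : Measure Y) (f '' s) := by
          change _ * (ENNReal.ofReal (1 - η)⁻¹ ^ d * _) = _
          rw [← ENNReal.ofReal_pow (by positivity), ← mul_assoc, ← ENNReal.ofReal_mul (by positivity),
            ← mul_pow, mul_inv_cancel₀ h0.ne']
          simp

end MeasureComparison

/-! ### Exact flux formula on a boundary patch. -/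

section Patch

open Set Filter Topology

variable {V : Type*} [NormedAddCommGroup V] [InnerProductSpace ℝ V]

/-- The projection to the hyperplane `n^⊥` along the direction `v`. -/
noncomputable def slantProj (n v : V) : V →L[ℝ] (ℝ ∙ n)ᗮ :=
  (ℝ ∙ n)ᗮ.orthogonalProjectionOnto ∘L
    (ContinuousLinearMap.id ℝ V - ((⟪n, v⟫_ℝ)⁻¹ • innerSL ℝ n).smulRight v)

/-- The vector on the right already lies in n^⊥; the orthogonal projection in `slantProj` only
supplies the subtype. -/
theorem coe_slantProj {n v : V} (hc : ⟪n, v⟫_ℝ ≠ 0) (x : V) :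
    (slantProj n v x : V) = x - (⟪n, x⟫_ℝ / ⟪n, v⟫_ℝ) • v := by
  have h : x - (⟪n, x⟫_ℝ / ⟪n, v⟫_ℝ) • v ∈ (ℝ ∙ n)ᗮ := by
    rw [Submodule.mem_orthogonal_singleton_iff_inner_right, inner_sub_right, inner_smul_right,
      div_mul_cancel₀ _ hc, sub_self]
  have h2 : slantProj n v x =
      (ℝ ∙ n)ᗮ.orthogonalProjectionOnto (x - (⟪n, x⟫_ℝ / ⟪n, v⟫_ℝ) • v) := by
    simp [slantProj, div_eq_inv_mul]
  rw [h2]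
  exact congrArg Subtype.val (Submodule.orthogonalProjectionOnto_mem_subspace_eq_self ⟨_, h⟩)

theorem slantProj_smul_add {n v : V} (hc : ⟪n, v⟫_ℝ ≠ 0) (t : ℝ) (y : (ℝ ∙ n)ᗮ) :
    slantProj n v (t • v + y) = y := by
  have hy : ⟪n, (y : V)⟫_ℝ = 0 :=
    Submodule.mem_orthogonal_singleton_iff_inner_right.1 y.2
  apply Subtype.ext
  rw [coe_slantProj hc, inner_add_right, inner_smul_right, hy, add_zero, mul_div_cancel_right₀ _ hc,
    add_sub_cancel_left]

theorem smul_add_slantProj {n v : V} (hc : ⟪n, v⟫_ℝ ≠ 0) (x : V) :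
    (⟪n, x⟫_ℝ / ⟪n, v⟫_ℝ) • v + (slantProj n v x : V) = x := by
  rw [coe_slantProj hc, add_sub_cancel]

/-- The hypothesis says that the chord x - y is almost orthogonal to n, so projecting it along v
changes it by at most η‖x - y‖. -/
theorem dist_slantProj_bounds {n v x y : V} {η : ℝ} (hc : 0 < ⟪n, v⟫_ℝ)
    (h : |⟪n, x - y⟫_ℝ| * ‖v‖ ≤ η * ⟪n, v⟫_ℝ * ‖x - y‖) :
    dist (slantProj n v x) (slantProj n v y) ≤ (1 + η) * dist x y ∧
      (1 - η) * dist x y ≤ dist (slantProj n v x) (slantProj n v y) := by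
  have h1 : dist (slantProj n v x) (slantProj n v y) =
      ‖(x - y) - (⟪n, x - y⟫_ℝ / ⟪n, v⟫_ℝ) • v‖ := by
    rw [dist_eq_norm, ← map_sub, ← coe_slantProj hc.ne']; rfl
  have h2 : ‖(⟪n, x - y⟫_ℝ / ⟪n, v⟫_ℝ) • v‖ ≤ η * ‖x - y‖ := by
    rw [norm_smul, Real.norm_eq_abs, abs_div, abs_of_pos hc, div_mul_eq_mul_div, div_le_iff₀ hc]
    linarith
  rw [h1, dist_eq_norm]
  have h3 := norm_sub_le (x - y) ((⟪n, x - y⟫_ℝ / ⟪n, v⟫_ℝ) • v)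
  have h4 := norm_sub_norm_le (x - y) ((⟪n, x - y⟫_ℝ / ⟪n, v⟫_ℝ) • v)
  constructor <;> linarith

variable [FiniteDimensional ℝ V] [MeasurableSpace V] [BorelSpace V]

/-- The fundamental theorem of calculus along the lines of direction `v` which cross the
boundary patch `{x ∈ B | ρ x = 0}` transversally. -/
theorem setIntegral_fderiv_eq_integral_comap_slantProj {Ω B Γ : Set V} (hΩ : MeasurableSet Ω)
    {n v : V} (hn : ‖n‖ = 1) (hc : 0 < ⟪n, v⟫_ℝ) (hB : Convex ℝ B) {ρ : V → ℝ}
    (hρ : ContinuousOn ρ B) (hin : ∀ x ∈ B, x ∈ Ω ↔ ρ x < 0)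
    (hmono : ∀ x ∈ B, ∀ s : ℝ, 0 < s → x + s • v ∈ B → ρ x < ρ (x + s • v))
    (hΓ : ∀ x, x ∈ Γ ↔ x ∈ B ∧ ρ x = 0)
    (hemb : MeasurableEmbedding fun x : Γ => slantProj n v x)
    {G : V → ℝ} (hG : ContDiff ℝ 1 G) (hGc : HasCompactSupport G) (hGB : tsupport G ⊆ B) :
    ∫ x in Ω, fderiv ℝ G x v =
      ⟪n, v⟫_ℝ * ∫ x : Γ, G x ∂(Measure.comap (fun x : Γ => slantProj n v x) volume) := by
  have hv : v ≠ 0 := fun h => by simp [h] at hc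
  have hG' : Continuous fun x => fderiv ℝ G x v :=
    (hG.continuous_fderiv (by norm_num)).clm_apply continuous_const
  have hint : Integrable fun x => fderiv ℝ G x v :=
    hG'.integrable_of_hasCompactSupport (hGc.fderiv_apply (𝕜 := ℝ) v)
  rw [← integral_indicator hΩ, integral_eq_inner_mul_integral_integral hn hc
    (hint.indicator hΩ)]
  congr 1
  -- `Ψ y` collects the contribution of the line y + ℝv. It equals G at the point where the line
  -- crosses Γ, and 0 if the line misses Γ.
  set Ψ : (ℝ ∙ n)ᗮ → ℝ := fun y => ∫ t : ℝ, Ω.indicator (fun x => fderiv ℝ G x v) (t • v + (y : V))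
    with hΨ
  set ℓ : (ℝ ∙ n)ᗮ → ℝ → V := fun y t => t • v + (y : V) with hℓ
  have hℓc : ∀ y, Continuous (ℓ y) := fun y => by fun_prop
  have hΨ' : ∀ y, Ψ y = ∫ t in (ℓ y) ⁻¹' Ω, fderiv ℝ G (ℓ y t) v := fun y => by
    rw [← integral_indicator ((hℓc y).measurable hΩ)]; rfl
  have hder : ∀ y t, HasDerivAt (fun t => G (ℓ y t)) (fderiv ℝ G (ℓ y t) v) t := fun y t => by
    have h1 : HasDerivAt (ℓ y) v t := by
      have h0 := ((hasDerivAt_id t).smul_const v).add_const (y : V)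
      rwa [one_smul] at h0
    exact ((hG.differentiable (by norm_num)) (ℓ y t)).hasFDerivAt.comp_hasDerivAt t h1
  have hcs : ∀ y, HasCompactSupport fun t => G (ℓ y t) := fun y =>
    hGc.comp_isClosedEmbedding ((Homeomorph.addRight (y : V)).isClosedEmbedding.comp
      (isClosedEmbedding_smul_left hv))
  have hI : ∀ y t, fderiv ℝ G (ℓ y t) v ≠ 0 → t ∈ (ℓ y) ⁻¹' B := fun y t h => by
    refine hGB (support_fderiv_subset ℝ (f := G) ?_)
    intro h0
    exact h (by rw [h0]; rfl)
  -- Convexity of B makes its trace on each line an interval, as the intermediate value argument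
  -- requires.
  have hIc : ∀ y, IsPreconnected ((ℓ y) ⁻¹' B) := fun y => by
    have : Convex ℝ ((ℓ y) ⁻¹' B) := by
      have h2 := (hB.translate_preimage_left (y : V)).linear_preimage
        ((LinearMap.id : ℝ →ₗ[ℝ] ℝ).smulRight v)
      exact h2
    exact this.isPreconnected
  have hρc : ∀ y, ContinuousOn (fun t => ρ (ℓ y t)) ((ℓ y) ⁻¹' B) := fun y =>
    hρ.comp (hℓc y).continuousOn (mapsTo_preimage _ _)
  have hmon : ∀ y, StrictMonoOn (fun t => ρ (ℓ y t)) ((ℓ y) ⁻¹' B) := fun y a ha b hb hab => by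
    have h1 : ℓ y a + (b - a) • v = ℓ y b := by simp only [hℓ]; module
    have h2 := hmono (ℓ y a) ha (b - a) (sub_pos.2 hab) (by rw [h1]; exact hb)
    rwa [h1] at h2
  have hval : ∀ x : Γ, Ψ (slantProj n v x) = G x := fun x => by
    obtain ⟨hxB, hx0⟩ := (hΓ x).1 x.2
    have e := smul_add_slantProj hc.ne' (x : V)
    rw [hΨ', setIntegral_deriv_of_zero (t₀ := ⟪n, (x : V)⟫_ℝ / ⟪n, v⟫_ℝ)
      ((hℓc _).measurable hΩ) (hder _) (hG'.comp (hℓc _)) (hcs _) (hI _) (hmon _)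
      (fun t ht => hin _ ht) (by simpa only [mem_preimage, hℓ, e] using hxB)
      (by simpa only [hℓ, e] using hx0)]
    simp only [hℓ, e]
  have hzero : ∀ y, y ∉ range (fun x : Γ => slantProj n v x) → Ψ y = 0 := fun y hy => by
    rw [hΨ']
    refine setIntegral_deriv_of_no_zero ((hℓc _).measurable hΩ) (hder _) (hG'.comp (hℓc _))
      (hcs _) (hI _) (hIc _) (hρc _) (fun t ht => hin _ ht) fun t ht h0 => hy ?_
    exact ⟨⟨ℓ y t, (hΓ _).2 ⟨ht, h0⟩⟩, slantProj_smul_add hc.ne' t y⟩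
  -- `Ψ` lives on the projection of Γ, so pulling back along the embedding gives an integral over Γ
  -- with no Jacobian.
  calc ∫ y, Ψ y = ∫ y in range (fun x : Γ => slantProj n v x), Ψ y :=
        (setIntegral_eq_integral_of_forall_compl_eq_zero hzero).symm
    _ = ∫ x : Γ, Ψ (slantProj n v x) ∂(Measure.comap (fun x : Γ => slantProj n v x) volume) := by
        rw [← hemb.map_comap, hemb.integral_map]
    _ = _ := by simp only [hval]

end Patch

/-! ### Approximate divergence theorem near a boundary point. -/

section LocalDivergence

open Set Filter Topology

/-- The inclusion of Γ is an isometry, so the intrinsic Hausdorff measure of Γ is the restriction of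
the ambient one. -/
theorem integral_frontier_eq_integral_subtype {V : Type*} [NormedAddCommGroup V]
    [MeasurableSpace V] [BorelSpace V] {Γ S : Set V} (hΓ : MeasurableSet Γ)
    (hS : MeasurableSet S) (hΓS : Γ ⊆ S) {G : V → ℝ} (hG : ∀ x ∈ S, x ∉ Γ → G x = 0) (d : ℕ) :
    ∫ x in S, G x ∂(μHE[d] : Measure V) = ∫ x : Γ, G x ∂(μHE[d] : Measure Γ) := by
  rw [setIntegral_eq_of_subset_of_forall_sdiff_eq_zero hS hΓS (fun x hx => hG x hx.1 hx.2)]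
  have h := Isometry.map_euclideanHausdorffMeasure (d := d) (isometry_subtype_coe (s := Γ))
  rw [Subtype.range_coe] at h
  rw [← h, (MeasurableEmbedding.subtype_coe hΓ).integral_map]

variable {V : Type*} [NormedAddCommGroup V] [InnerProductSpace ℝ V]

/-- Strict differentiability controls ρ x - ρ y for all pairs near p, not only against p. The
frontier is the zero set because a zero of ρ is approached from Ω in the direction -n. -/
theorem exists_flat_ball {Ω U : Set V} (hΩ : IsOpen Ω) {p n : V} (hn : ‖n‖ = 1) {ρ : V → ℝ}
    {κ : ℝ} (hκ : 0 < κ) (hU : U ∈ 𝓝 p) (hρU : ContinuousOn ρ U)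
    (hin : ∀ x ∈ U, x ∈ Ω ↔ ρ x < 0) (hρ : HasStrictFDerivAt ρ (κ • innerSL ℝ n) p)
    {δ : ℝ} (hδ : 0 < δ) :
    ∃ r > 0, Metric.closedBall p r ⊆ U ∧
      (∀ x ∈ Metric.closedBall p r, x ∈ frontier Ω ↔ ρ x = 0) ∧
      ∀ x ∈ Metric.closedBall p r, ∀ y ∈ Metric.closedBall p r,
        |ρ x - ρ y - κ * ⟪n, x - y⟫_ℝ| ≤ δ * κ * ‖x - y‖ := by
  have key : ∀ δ : ℝ, 0 < δ → ∃ r > 0, ∀ x ∈ Metric.ball p r, ∀ y ∈ Metric.ball p r,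
      |ρ x - ρ y - κ * ⟪n, x - y⟫_ℝ| ≤ δ * κ * ‖x - y‖ := by
    intro δ hδ
    have h1 := hρ.isLittleO.def (mul_pos hδ hκ)
    rw [nhds_prod_eq] at h1
    obtain ⟨r, hr, h2⟩ := Metric.eventually_nhds_iff.1 (by rwa [← nhds_prod_eq] at h1)
    refine ⟨r, hr, fun x hx y hy => ?_⟩
    have h3 := h2 (y := (x, y)) (by
      rw [Prod.dist_eq]; exact max_lt (Metric.mem_ball.1 hx) (Metric.mem_ball.1 hy))
    simpa [inner_sub_right, mul_sub] using h3
  obtain ⟨r₁, hr₁, k₁⟩ := key δ hδ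
  -- Since δ may be large, a second radius with constant 1/2 is taken: it gives ρ(x - s n) ≤ -κs/2 <
  -- 0 whenever ρ x = 0 and s > 0 is small.
  obtain ⟨r₂, hr₂, k₂⟩ := key (1 / 2) (by norm_num)
  obtain ⟨r₃, hr₃, hU'⟩ := Metric.mem_nhds_iff.1 hU
  obtain ⟨r, hr, hlt⟩ : ∃ r > 0, r < min r₁ (min r₂ r₃) :=
    exists_between (lt_min hr₁ (lt_min hr₂ hr₃))
  have l1 : r < r₁ := hlt.trans_le (min_le_left _ _)
  have l2 : r < r₂ := hlt.trans_le ((min_le_right _ _).trans (min_le_left _ _))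
  have l3 : r < r₃ := hlt.trans_le ((min_le_right _ _).trans (min_le_right _ _))
  have hBU : Metric.ball p r₃ ⊆ U := hU'
  refine ⟨r, hr, (Metric.closedBall_subset_ball l3).trans hBU, fun x hx => ?_, fun x hx y hy =>
    k₁ x (Metric.closedBall_subset_ball l1 hx) y (Metric.closedBall_subset_ball l1 hy)⟩
  have hx3 := Metric.closedBall_subset_ball l3 hx
  have hx2 := Metric.closedBall_subset_ball l2 hx
  have hxU := hBU hx3
  have hUx : U ∈ 𝓝 x := mem_of_superset (Metric.isOpen_ball.mem_nhds hx3) hBU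
  have hcx : ContinuousAt ρ x := hρU.continuousAt hUx
  rw [hΩ.frontier_eq]
  constructor
  · rintro ⟨hcl, hnot⟩
    refine le_antisymm (not_lt.1 fun hpos => ?_) (not_lt.1 fun h => hnot ((hin x hxU).2 h))
    have h1 : ∀ᶠ y in 𝓝 x, 0 < ρ y ∧ y ∈ U := (hcx.eventually (lt_mem_nhds hpos)).and hUx
    obtain ⟨y, hyΩ, hy0, hyU⟩ := ((mem_closure_iff_frequently.1 hcl).and_eventually h1).exists
    exact absurd ((hin y hyU).1 hyΩ) (not_lt.2 hy0.le)
  · intro h0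
    refine ⟨?_, fun hxΩ => absurd ((hin x hxU).1 hxΩ) (by simp [h0])⟩
    have ht : Tendsto (fun s : ℝ => x - s • n) (𝓝[>] 0) (𝓝 x) := by
      have : Continuous fun s : ℝ => x - s • n := by fun_prop
      simpa using (this.tendsto 0).mono_left (nhdsWithin_le_nhds (s := Ioi 0))
    refine mem_closure_of_tendsto ht ?_
    filter_upwards [ht (Metric.isOpen_ball.mem_nhds hx2), ht hUx, self_mem_nhdsWithin]
      with s hs2 hsU hs
    have hs0 : (0 : ℝ) < s := hs
    have h5 := k₂ (x - s • n) hs2 x hx2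
    rw [h0, sub_sub_cancel_left, norm_neg, norm_smul, hn, inner_neg_right, inner_smul_right,
      real_inner_self_eq_norm_sq, hn, Real.norm_eq_abs, abs_of_pos hs0] at h5
    refine (hin _ hsU).2 ?_
    have h6 := (abs_le.1 h5).2
    have := mul_pos hκ hs0
    nlinarith

variable [FiniteDimensional ℝ V] [MeasurableSpace V] [BorelSpace V]

/-- The exact patch formula uses the pulled-back Lebesgue measure; on a small ball this measure and
surface area differ by a factor within 1 ± ε'. -/
theorem exists_ball_setIntegral_fderiv_near {Ω U : Set V} (hΩ : IsOpen Ω) {p n v : V}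
    (hn : ‖n‖ = 1) (hc : 0 < ⟪n, v⟫_ℝ) {ρ : V → ℝ} {κ : ℝ} (hκ : 0 < κ) (hU : U ∈ 𝓝 p)
    (hρU : ContinuousOn ρ U) (hin : ∀ x ∈ U, x ∈ Ω ↔ ρ x < 0)
    (hρ : HasStrictFDerivAt ρ (κ • innerSL ℝ n) p) {ε : ℝ} (hε : 0 < ε) :
    ∃ r > 0, (μHE[Module.finrank ℝ V - 1] : Measure V) (frontier Ω ∩ Metric.closedBall p r) < ⊤ ∧
      ∀ G : V → ℝ, ContDiff ℝ 1 G → tsupport G ⊆ Metric.ball p r →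
        |(∫ x in Ω, fderiv ℝ G x v) -
          ⟪n, v⟫_ℝ * ∫ x in frontier Ω, G x ∂(μHE[Module.finrank ℝ V - 1] : Measure V)| ≤
        ε * ∫ x in frontier Ω, |G x| ∂(μHE[Module.finrank ℝ V - 1] : Measure V) := by
  set d := Module.finrank ℝ V - 1 with hd
  set c := ⟪n, v⟫_ℝ with hc_def
  have hn0 : n ≠ 0 := fun h => by simp [h] at hn
  have hv : 0 < ‖v‖ := norm_pos_iff.2 fun h => by simp [hc_def, h] at hc
  have hfin : Module.finrank ℝ (ℝ ∙ n)ᗮ = d := by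
    have := (ℝ ∙ n).finrank_add_finrank_orthogonal
    rw [finrank_span_singleton hn0] at this
    omega
  -- The error is finally multiplied by c, whence ε/c; the bound 1/2 keeps 1 - ε' positive, which
  -- yields finite area of the patch.
  obtain ⟨ε', hε'0, hε'⟩ : ∃ ε' > 0, ε' < min (1 / 2) (ε / c) :=
    exists_between (lt_min (by norm_num) (div_pos hε hc))
  have hε'1 : ε' < 1 / 2 := hε'.trans_le (min_le_left _ _)
  have hε'2 : c * ε' ≤ ε := by
    have := (hε'.trans_le (min_le_right _ _)).le
    rwa [le_div_iff₀ hc, mul_comm] at this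
  obtain ⟨η, hη0, hη1, hup, hlo⟩ := exists_pow_near_one d hε'0
  -- This flatness serves twice: chords of {ρ = 0} satisfy the hypothesis of
  -- `dist_slantProj_bounds`, and ρ grows by at least (1 - η)κsc along s v.
  have hδ : 0 < η * c / ‖v‖ := by positivity
  obtain ⟨r, hr, hBU, hfr, hflat⟩ := exists_flat_ball hΩ hn hκ hU hρU hin hρ hδ
  set B := Metric.closedBall p r with hB
  set Γ := frontier Ω ∩ B with hΓ_def
  have hΓc : IsCompact Γ := (isCompact_closedBall p r).inter_left isClosed_frontier
  have : CompactSpace Γ := isCompact_iff_compactSpace.1 hΓc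
  have hΓ : ∀ x, x ∈ Γ ↔ x ∈ B ∧ ρ x = 0 := fun x => by
    rw [hΓ_def, mem_inter_iff, and_comm]
    exact and_congr_right fun hx => hfr x hx
  have hmono : ∀ x ∈ B, ∀ s : ℝ, 0 < s → x + s • v ∈ B → ρ x < ρ (x + s • v) := by
    intro x hx s hs hxs
    have h1 := hflat _ hxs x hx
    rw [add_sub_cancel_left, inner_smul_right, norm_smul, Real.norm_eq_abs, abs_of_pos hs] at h1
    have h2 := (abs_le.1 h1).1
    have h3 : η * c / ‖v‖ * κ * (s * ‖v‖) = η * (κ * s * c) := by field_simp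
    have h4 : 0 < κ * s * c := by positivity
    rw [h3] at h2
    nlinarith
  have hbounds : ∀ x y : Γ, dist (slantProj n v x) (slantProj n v y) ≤ (1 + η) * dist x y ∧
      (1 - η) * dist x y ≤ dist (slantProj n v x) (slantProj n v y) := by
    intro x y
    refine dist_slantProj_bounds hc ?_
    obtain ⟨hx, hx0⟩ := (hΓ x).1 x.2
    obtain ⟨hy, hy0⟩ := (hΓ y).1 y.2
    have h1 := hflat _ hx _ hy
    rw [hx0, hy0, sub_zero, zero_sub, abs_neg, abs_mul, abs_of_pos hκ] at h1
    have h2 : |⟪n, (x : V) - y⟫_ℝ| ≤ η * c / ‖v‖ * ‖(x : V) - y‖ := by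
      refine le_of_mul_le_mul_left ?_ hκ
      linarith
    calc |⟪n, (x : V) - y⟫_ℝ| * ‖v‖ ≤ η * c / ‖v‖ * ‖(x : V) - y‖ * ‖v‖ := by gcongr
      _ = η * c * ‖(x : V) - y‖ := by field_simp
  have hinj : Function.Injective fun x : Γ => slantProj n v x := by
    intro x y hxy
    have h1 := (hbounds x y).2
    have h2 : slantProj n v x = slantProj n v y := hxy
    rw [h2, dist_self] at h1
    exact dist_le_zero.1 (nonpos_of_mul_nonpos_right h1 (by linarith))
  have hcont : Continuous fun x : Γ => slantProj n v x := by fun_prop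
  have hemb : MeasurableEmbedding fun x : Γ => slantProj n v x :=
    (hcont.isClosedEmbedding hinj).measurableEmbedding
  obtain ⟨hle, hge⟩ := euclideanHausdorffMeasure_comap_bounds hemb hη0 hη1 hup hlo
    (fun x y => (hbounds x y).1) (fun x y => (hbounds x y).2)
  have hvol : (μHE[d] : Measure (ℝ ∙ n)ᗮ) = volume := by
    rw [← hfin]; exact InnerProductSpace.euclideanHausdorffMeasure_eq_volume
  rw [hvol] at hle hge
  -- The area of Γ is at most (1 - ε')⁻¹ times the Lebesgue measure of its compact projection.
  have hfinite : (μHE[d] : Measure Γ) univ < ⊤ := by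
    have h1 : Measure.comap (fun x : Γ => slantProj n v x) volume univ < ⊤ := by
      rw [hemb.comap_apply, image_univ]
      exact (isCompact_range hcont).measure_lt_top
    have h2 := (hge univ).trans_lt h1
    rw [Measure.smul_apply, smul_eq_mul] at h2
    exact ENNReal.lt_top_of_mul_ne_top_right h2.ne
      (by simp only [ne_eq, ENNReal.ofReal_eq_zero, not_le]; linarith)
  have : IsFiniteMeasure (μHE[d] : Measure Γ) := ⟨hfinite⟩
  refine ⟨r, hr, ?_, fun G hG hGB => ?_⟩
  · have h1 := isometry_subtype_coe.euclideanHausdorffMeasure_image (d := d) (univ : Set Γ)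
    rw [image_univ, Subtype.range_coe] at h1
    rw [h1]; exact hfinite
  · have hGB' : tsupport G ⊆ B := hGB.trans Metric.ball_subset_closedBall
    have hGc : HasCompactSupport G :=
      (isCompact_closedBall p r).of_isClosed_subset (isClosed_tsupport G) hGB'
    have hGint : Integrable (fun x : Γ => G x) μHE[d] :=
      (hG.continuous.comp continuous_subtype_val).integrable_of_hasCompactSupport
        (HasCompactSupport.of_compactSpace _)
    have hz : ∀ x ∈ frontier Ω, x ∉ Γ → G x = 0 := fun x hx hxΓ =>
      image_eq_zero_of_notMem_tsupport fun h => hxΓ ⟨hx, hGB' h⟩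
    rw [setIntegral_fderiv_eq_integral_comap_slantProj hΩ.measurableSet hn hc
      (convex_closedBall p r) (hρU.mono hBU) (fun x hx => hin x (hBU hx)) hmono hΓ hemb hG hGc hGB',
      integral_frontier_eq_integral_subtype hΓc.measurableSet isClosed_frontier.measurableSet
        inter_subset_left hz d,
      integral_frontier_eq_integral_subtype (G := fun x => |G x|) hΓc.measurableSet
        isClosed_frontier.measurableSet
        inter_subset_left (fun x hx hxΓ => by rw [hz x hx hxΓ, abs_zero]) d,
      ← hc_def, ← mul_sub, abs_mul, abs_of_pos hc]
    have h1 := abs_integral_sub_integral_le_of_measure_le hε'0.le (by linarith) hle hge hGint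
    calc c * _ ≤ c * (ε' * ∫ x : Γ, |G x| ∂μHE[d]) := by gcongr
      _ = (c * ε') * ∫ x : Γ, |G x| ∂μHE[d] := by ring
      _ ≤ _ := by
        gcongr

end LocalDivergence

namespace HigherSpin

open Set Filter Topology

/-! ### The outward normal: independence of the defining function, and continuity. -/

section Normal

variable {m : ℕ} {Ω : Set (E m)} {p : E m} {ρ : E m → ℝ}

theorem fderiv_eq_innerSL_gradient (ρ : E m → ℝ) (p : E m) :
    fderiv ℝ ρ p = innerSL ℝ (gradient ρ p) := by
  ext w
  rw [innerSL_apply_apply, gradient, InnerProductSpace.toDual_symm_apply]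

theorem eventually_lineMap_neg {a v : E m} (hρ : HasFDerivAt ρ (innerSL ℝ a) p) (h0 : ρ p = 0)
    (ha : ⟪a, v⟫_ℝ < 0) : ∀ᶠ t : ℝ in 𝓝[>] 0, ρ (p + t • v) < 0 := by
  have h1 : HasDerivAt (fun t : ℝ => p + t • v) v 0 := by
    have := ((hasDerivAt_id (0 : ℝ)).smul_const v).const_add p
    rwa [one_smul] at this
  have h2 : HasDerivAt (fun t : ℝ => ρ (p + t • v)) ⟪a, v⟫_ℝ 0 := by
    have h3 : HasFDerivAt ρ (innerSL ℝ a) (p + (0 : ℝ) • v) := by simpa using hρ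
    exact h3.comp_hasDerivAt (0 : ℝ) h1
  have h4 := h2.tendsto_slope.mono_left
    (nhdsWithin_mono (0 : ℝ) (fun t (ht : 0 < t) => ht.ne' : Ioi (0 : ℝ) ⊆ {0}ᶜ))
  filter_upwards [h4.eventually (gt_mem_nhds ha), self_mem_nhdsWithin] with t ht ht0
  have ht0 : (0 : ℝ) < t := ht0
  rw [slope_def_field] at ht
  simp only [zero_smul, add_zero, h0, sub_zero] at ht
  have := mul_neg_of_neg_of_pos ht ht0
  rwa [div_mul_cancel₀ _ ht0.ne'] at this

theorem IsDefiningFunction.contDiffAt (h : IsDefiningFunction Ω p ρ) : ContDiffAt ℝ 1 ρ p := by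
  obtain ⟨U, hU, hp, hρ, -⟩ := h
  exact hρ.contDiffAt (hU.mem_nhds hp)

theorem IsDefiningFunction.hasStrictFDerivAt (h : IsDefiningFunction Ω p ρ) :
    HasStrictFDerivAt ρ (innerSL ℝ (gradient ρ p)) p := by
  rw [← fderiv_eq_innerSL_gradient]
  exact h.contDiffAt.hasStrictFDerivAt (by norm_num)

theorem IsDefiningFunction.eq_zero (hΩ : IsOpen Ω) (hp : p ∈ frontier Ω)
    (h : IsDefiningFunction Ω p ρ) : ρ p = 0 := by
  have hc := h.contDiffAt.continuousAt
  obtain ⟨U, hU, hpU, hρ, hin, -⟩ := h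
  rw [hΩ.frontier_eq] at hp
  refine le_antisymm (not_lt.1 fun hpos => ?_) (not_lt.1 fun hlt => hp.2 ((hin p hpU).2 hlt))
  have h1 : ∀ᶠ y in 𝓝 p, 0 < ρ y ∧ y ∈ U :=
    (hc.eventually (lt_mem_nhds hpos)).and (hU.mem_nhds hpU)
  obtain ⟨y, hyΩ, hy0, hyU⟩ := ((mem_closure_iff_frequently.1 hp.1).and_eventually h1).exists
  exact absurd ((hin y hyU).1 hyΩ) (not_lt.2 hy0.le)

/-- Strict Cauchy–Schwarz for two distinct unit vectors. -/
theorem inner_normalize_sub_neg {a b : E m} (ha : a ≠ 0) (hb : b ≠ 0)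
    (h : ‖a‖⁻¹ • a ≠ ‖b‖⁻¹ • b) : ⟪a, ‖b‖⁻¹ • b - ‖a‖⁻¹ • a⟫_ℝ < 0 := by
  have hlt := inner_lt_one_iff_real_of_norm_eq_one (x := ‖a‖⁻¹ • a) (y := ‖b‖⁻¹ • b)
    (norm_smul_inv_norm ha) (norm_smul_inv_norm hb)
  have h1 := hlt.2 h
  have ha' : 0 < ‖a‖ := norm_pos_iff.2 ha
  rw [inner_smul_left] at h1
  rw [inner_sub_right, inner_smul_right _ a, real_inner_self_eq_norm_sq, sq, ← mul_assoc,
    inv_mul_cancel₀ ha'.ne', one_mul]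
  have h2 : ⟪a, ‖b‖⁻¹ • b⟫_ℝ < ‖a‖ := by
    rw [RCLike.conj_to_real, inv_mul_lt_iff₀ ha', mul_one] at h1
    exact h1
  linarith

/-- If the unit gradients differed, their difference v would point strictly into {ρ < 0} and
strictly into {ρ' > 0}; the points p + t v with small t > 0 would be both inside and outside Ω. -/
theorem IsDefiningFunction.normalize_gradient_eq {ρ' : E m → ℝ} (hΩ : IsOpen Ω)
    (hp : p ∈ frontier Ω) (h : IsDefiningFunction Ω p ρ) (h' : IsDefiningFunction Ω p ρ') :
    ‖gradient ρ p‖⁻¹ • gradient ρ p = ‖gradient ρ' p‖⁻¹ • gradient ρ' p := by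
  by_contra hne
  have h0 := h.eq_zero hΩ hp
  have h0' := h'.eq_zero hΩ hp
  have hd := h.hasStrictFDerivAt.hasFDerivAt
  have hd' := h'.hasStrictFDerivAt.hasFDerivAt
  obtain ⟨U, hU, hpU, -, hin, hg⟩ := h
  obtain ⟨U', hU', hpU', -, hin', hg'⟩ := h'
  set a := gradient ρ p
  set b := gradient ρ' p
  set v := ‖b‖⁻¹ • b - ‖a‖⁻¹ • a with hv
  have h1 : ⟪a, v⟫_ℝ < 0 := inner_normalize_sub_neg hg hg' hne
  have h2 : ⟪b, -v⟫_ℝ < 0 := by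
    rw [hv, neg_sub]; exact inner_normalize_sub_neg hg' hg (Ne.symm hne)
  have hnd : HasFDerivAt (fun x => -ρ' x) (innerSL ℝ (-b)) p := by
    rw [map_neg]; exact hd'.neg
  have e1 := eventually_lineMap_neg hd h0 h1
  have e2 := eventually_lineMap_neg hnd (by rw [h0', neg_zero])
    (show ⟪-b, v⟫_ℝ < 0 by rwa [inner_neg_left, ← inner_neg_right])
  have ht : Tendsto (fun t : ℝ => p + t • v) (𝓝[>] 0) (𝓝 p) := by
    have : Continuous fun t : ℝ => p + t • v := by fun_prop
    simpa using (this.tendsto 0).mono_left (nhdsWithin_le_nhds (s := Ioi 0))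
  obtain ⟨t, ht1, ht2, ht3, ht4⟩ := (e1.and (e2.and ((ht.eventually (hU.mem_nhds hpU)).and
    (ht.eventually (hU'.mem_nhds hpU'))))).exists
  have := (hin' _ ht4).1 ((hin _ ht3).2 ht1)
  linarith

theorem IsDefiningFunction.outwardNormal_eq (hΩ : IsOpen Ω) (hp : p ∈ frontier Ω)
    (h : IsDefiningFunction Ω p ρ) :
    outwardNormal Ω p = ‖gradient ρ p‖⁻¹ • gradient ρ p := by
  have hex : ∃ ρ, IsDefiningFunction Ω p ρ := ⟨ρ, h⟩
  rw [outwardNormal, dif_pos hex]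
  exact hex.choose_spec.normalize_gradient_eq hΩ hp h

theorem IsDefiningFunction.continuousAt_gradient (h : IsDefiningFunction Ω p ρ) :
    ContinuousAt (gradient ρ) p := by
  have h1 : ContinuousAt (fderiv ℝ ρ) p := h.contDiffAt.continuousAt_fderiv (by norm_num)
  exact ((InnerProductSpace.toDual ℝ (E m)).symm.continuous.continuousAt).comp h1

theorem IsDefiningFunction.eventually (h : IsDefiningFunction Ω p ρ) :
    ∀ᶠ q in 𝓝 p, IsDefiningFunction Ω q ρ := by
  have hc := h.continuousAt_gradient
  obtain ⟨U, hU, hpU, hρ, hin, hg⟩ := h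
  filter_upwards [hU.mem_nhds hpU, hc.eventually_ne hg] with q hq hgq
  exact ⟨U, hU, hq, hρ, hin, hgq⟩

/-- A defining function at p also serves at nearby boundary points, so the pointwise choices agree
there with the continuous field ∇ρ/|∇ρ|. -/
theorem continuousOn_outwardNormal (hΩ : IsOpen Ω) (hb : HasC1Boundary Ω) :
    ContinuousOn (outwardNormal Ω) (frontier Ω) := by
  intro p hp
  obtain ⟨ρ, h⟩ := hb p hp
  have h1 : ContinuousAt (fun q => ‖gradient ρ q‖⁻¹ • gradient ρ q) p := by
    have hg : gradient ρ p ≠ 0 := by obtain ⟨_, _, _, _, _, hg⟩ := h; exact hg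
    exact (h.continuousAt_gradient.norm.inv₀ (norm_ne_zero_iff.2 hg)).smul h.continuousAt_gradient
  refine h1.continuousWithinAt.congr_of_eventuallyEq ?_ (h.outwardNormal_eq hΩ hp)
  filter_upwards [self_mem_nhdsWithin, nhdsWithin_le_nhds h.eventually] with q hq hdq
  exact hdq.outwardNormal_eq hΩ hq

end Normal

/-! ### Finite boundary area, and the local estimate for arbitrary directions. -/

section Local

variable {m : ℕ} {Ω : Set (E m)} {p : E m}

theorem exists_ball_setIntegral_fderiv_near_of_inner_pos (hΩ : IsOpen Ω) (hb : HasC1Boundary Ω)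
    (hp : p ∈ frontier Ω) :
    ‖outwardNormal Ω p‖ = 1 ∧ ∀ v : E m, 0 < ⟪outwardNormal Ω p, v⟫_ℝ → ∀ ε : ℝ, 0 < ε →
    ∃ r > 0, (μHE[m - 1] : Measure (E m)) (frontier Ω ∩ Metric.closedBall p r) < ⊤ ∧
      ∀ G : E m → ℝ, ContDiff ℝ 1 G → tsupport G ⊆ Metric.ball p r →
        |(∫ x in Ω, fderiv ℝ G x v) -
          ⟪outwardNormal Ω p, v⟫_ℝ * ∫ x, G x ∂boundaryArea Ω| ≤
        ε * ∫ x, |G x| ∂boundaryArea Ω := by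
  obtain ⟨ρ, h⟩ := hb p hp
  have hs := h.hasStrictFDerivAt
  rw [h.outwardNormal_eq hΩ hp]
  obtain ⟨U, hU, hpU, hρ, hin, hg⟩ := h
  have hκ : 0 < ‖gradient ρ p‖ := norm_pos_iff.2 hg
  have hn : ‖‖gradient ρ p‖⁻¹ • gradient ρ p‖ = 1 := norm_smul_inv_norm hg
  refine ⟨hn, fun v hv ε hε => ?_⟩
  have hs' : HasStrictFDerivAt ρ
      (‖gradient ρ p‖ • innerSL ℝ (‖gradient ρ p‖⁻¹ • gradient ρ p)) p := by
    rwa [← map_smul, smul_smul, mul_inv_cancel₀ hκ.ne', one_smul]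
  have := exists_ball_setIntegral_fderiv_near hΩ hn hv hκ (hU.mem_nhds hpU) hρ.continuousOn hin
    hs' hε
  rwa [finrank_euclideanSpace_fin] at this

/-- Each boundary point has a patch of finite area, and the frontier is compact. -/
theorem boundaryArea_univ_lt_top (hΩ : IsOpen Ω) (hbd : Bornology.IsBounded Ω)
    (hb : HasC1Boundary Ω) : boundaryArea Ω univ < ⊤ := by
  have hcomp : IsCompact (frontier Ω) :=
    hbd.isCompact_closure.of_isClosed_subset isClosed_frontier frontier_subset_closure
  rw [boundaryArea, Measure.restrict_apply_univ]
  refine hcomp.measure_lt_top_of_nhdsWithin fun p hp => ?_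
  obtain ⟨hn, h⟩ := exists_ball_setIntegral_fderiv_near_of_inner_pos hΩ hb hp
  obtain ⟨r, hr, hfin, -⟩ := h (outwardNormal Ω p)
    (by rw [real_inner_self_eq_norm_sq, hn]; norm_num) 1 one_pos
  exact ⟨_, inter_mem self_mem_nhdsWithin (nhdsWithin_le_nhds (Metric.closedBall_mem_nhds p hr)),
    hfin⟩

theorem integrable_boundaryArea_of_continuousOn {F : Type*} [NormedAddCommGroup F]
    (hΩ : IsOpen Ω) (hbd : Bornology.IsBounded Ω)
    (hb : HasC1Boundary Ω) {g : E m → F} (hg : ContinuousOn g (frontier Ω)) :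
    Integrable g (boundaryArea Ω) := by
  have hcomp : IsCompact (frontier Ω) :=
    hbd.isCompact_closure.of_isClosed_subset isClosed_frontier frontier_subset_closure
  have : IsFiniteMeasure (boundaryArea Ω) := ⟨boundaryArea_univ_lt_top hΩ hbd hb⟩
  obtain ⟨C, hC⟩ := hcomp.exists_bound_of_continuousOn hg
  refine Integrable.of_bound (C := C)
    (hg.aestronglyMeasurable_of_isCompact hcomp isClosed_frontier.measurableSet) ?_
  exact (ae_restrict_iff' isClosed_frontier.measurableSet).2 (Eventually.of_forall hC)

/-- Any v is the difference of v + K n and K n, both transversal to the boundary in the outward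
sense when K = |⟨n,v⟩| + 1. Continuity of the normal then replaces its value at p by its value at x;
each of the three errors costs ε/3. -/
theorem exists_ball_setIntegral_fderiv_near_inner_outwardNormal (hΩ : IsOpen Ω)
    (hbd : Bornology.IsBounded Ω) (hb : HasC1Boundary Ω)
    (hp : p ∈ frontier Ω) (v : E m) {ε : ℝ} (hε : 0 < ε) :
    ∃ r > 0, ∀ G : E m → ℝ, ContDiff ℝ 1 G → tsupport G ⊆ Metric.ball p r →
        |(∫ x in Ω, fderiv ℝ G x v) - ∫ x, G x * ⟪outwardNormal Ω x, v⟫_ℝ ∂boundaryArea Ω| ≤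
        ε * ∫ x, |G x| ∂boundaryArea Ω := by
  have hε3 : 0 < ε / 3 := by positivity
  obtain ⟨hn, h⟩ := exists_ball_setIntegral_fderiv_near_of_inner_pos hΩ hb hp
  set n := outwardNormal Ω p with hn_def
  set K := |⟪n, v⟫_ℝ| + 1 with hK
  have hnn : ⟪n, n⟫_ℝ = 1 := by rw [real_inner_self_eq_norm_sq, hn]; norm_num
  have hK0 : 0 < K := by positivity
  obtain ⟨r₁, hr₁, -, h₁⟩ := h (v + K • n)
    (by rw [inner_add_right, inner_smul_right, hnn]; linarith [neg_abs_le ⟪n, v⟫_ℝ]) _ hε3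
  obtain ⟨r₂, hr₂, -, h₂⟩ := h (K • n) (by rw [inner_smul_right, hnn]; linarith) _ hε3
  have hcn := continuousOn_outwardNormal hΩ hb
  have hcn' : ContinuousOn (fun x => ⟪outwardNormal Ω x, v⟫_ℝ) (frontier Ω) :=
    hcn.inner continuousOn_const
  obtain ⟨r₃, hr₃, h₃⟩ := Metric.continuousOn_iff.1 hcn' p hp _ hε3
  refine ⟨min r₁ (min r₂ r₃), lt_min hr₁ (lt_min hr₂ hr₃), fun G hG hGs => ?_⟩
  have s1 : tsupport G ⊆ Metric.ball p r₁ := hGs.trans (Metric.ball_subset_ball (min_le_left _ _))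
  have s2 : tsupport G ⊆ Metric.ball p r₂ :=
    hGs.trans (Metric.ball_subset_ball ((min_le_right _ _).trans (min_le_left _ _)))
  have s3 : tsupport G ⊆ Metric.ball p r₃ :=
    hGs.trans (Metric.ball_subset_ball ((min_le_right _ _).trans (min_le_right _ _)))
  have i1 := h₁ G hG s1
  have i2 := h₂ G hG s2
  have hGc : HasCompactSupport G := (isCompact_closedBall p r₁).of_isClosed_subset
    (isClosed_tsupport G) (s1.trans Metric.ball_subset_closedBall)
  have hint : ∀ w, Integrable (fun x => fderiv ℝ G x w) := fun w =>
    ((hG.continuous_fderiv (by norm_num)).clm_apply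
      continuous_const).integrable_of_hasCompactSupport (hGc.fderiv_apply (𝕜 := ℝ) w)
  have e1 : ∫ x in Ω, fderiv ℝ G x v =
      (∫ x in Ω, fderiv ℝ G x (v + K • n)) - ∫ x in Ω, fderiv ℝ G x (K • n) := by
    rw [← integral_sub (hint _).integrableOn (hint _).integrableOn]
    simp
  have iG : Integrable G (boundaryArea Ω) :=
    integrable_boundaryArea_of_continuousOn hΩ hbd hb hG.continuous.continuousOn
  have iGn : Integrable (fun x => G x * ⟪outwardNormal Ω x, v⟫_ℝ) (boundaryArea Ω) :=
    integrable_boundaryArea_of_continuousOn hΩ hbd hb (hG.continuous.continuousOn.mul hcn')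
  have i3 : |∫ x, G x * ⟪outwardNormal Ω x, v⟫_ℝ ∂boundaryArea Ω -
      ⟪n, v⟫_ℝ * ∫ x, G x ∂boundaryArea Ω| ≤ ε / 3 * ∫ x, |G x| ∂boundaryArea Ω := by
    rw [← integral_const_mul, ← integral_sub iGn (iG.const_mul _), ← integral_const_mul]
    rw [← Real.norm_eq_abs]
    refine norm_integral_le_of_norm_le (iG.abs.const_mul _) ?_
    refine (ae_restrict_iff' isClosed_frontier.measurableSet).2 (Eventually.of_forall ?_)
    intro x hx
    by_cases hx0 : G x = 0
    · simp [hx0]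
    · have hxb : x ∈ Metric.ball p r₃ := s3 (subset_tsupport G hx0)
      have h4 := h₃ x hx hxb
      rw [Real.dist_eq] at h4
      rw [Real.norm_eq_abs, mul_comm _ (G x), ← mul_sub, abs_mul, mul_comm]
      gcongr
  rw [inner_add_right] at i1
  rw [e1]
  rw [abs_le] at *
  constructor <;> linarith [i1.1, i1.2, i2.1, i2.2, i3.1, i3.2]

end Local

/-! ### Global divergence theorem by a partition of unity. -/

section Global

variable {m : ℕ} {Ω : Set (E m)}

theorem integral_fderiv_eq_zero_of_hasCompactSupport {G : E m → ℝ} (hG : ContDiff ℝ 1 G)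
    (hGc : HasCompactSupport G) (v : E m) : ∫ x, fderiv ℝ G x v = 0 := by
  have hint : Integrable (fun x => fderiv ℝ G x v) :=
    ((hG.continuous_fderiv (by norm_num)).clm_apply
      continuous_const).integrable_of_hasCompactSupport (hGc.fderiv_apply (𝕜 := ℝ) v)
  have h := integral_mul_fderiv_eq_neg_fderiv_mul_of_integrable (μ := volume)
    (f := fun _ : E m => (1 : ℝ)) (g := G) (v := v) (by simp) (by simpa using hint)
    (by simpa using hG.continuous.integrable_of_hasCompactSupport hGc)
    (fun x _ => differentiableAt_const _) (fun x _ => hG.differentiable (by norm_num) x)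
  simpa using h

/-- At an interior point the neighbourhood is Ω itself, where both integrals vanish for G supported
inside. -/
theorem exists_open_setIntegral_fderiv_near (hΩ : IsOpen Ω)
    (hbd : Bornology.IsBounded Ω) (hb : HasC1Boundary Ω) {p : E m}
    (hp : p ∈ closure Ω) (v : E m) {ε : ℝ} (hε : 0 < ε) :
    ∃ U : Set (E m), IsOpen U ∧ p ∈ U ∧
      ∀ G : E m → ℝ, ContDiff ℝ 1 G → tsupport G ⊆ U →
        |(∫ x in Ω, fderiv ℝ G x v) - ∫ x, G x * ⟪outwardNormal Ω x, v⟫_ℝ ∂boundaryArea Ω| ≤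
        ε * ∫ x, |G x| ∂boundaryArea Ω := by
  by_cases hpΩ : p ∈ Ω
  · refine ⟨Ω, hΩ, hpΩ, fun G hG hGs => ?_⟩
    have hGc : HasCompactSupport G := hbd.isCompact_closure.of_isClosed_subset
      (isClosed_tsupport G) (hGs.trans subset_closure)
    have h1 : ∫ x in Ω, fderiv ℝ G x v = 0 := by
      rw [setIntegral_eq_integral_of_forall_compl_eq_zero,
        integral_fderiv_eq_zero_of_hasCompactSupport hG hGc]
      intro x hx
      have h2 : fderiv ℝ G x = 0 := by
        by_contra hne
        exact hx (hGs (support_fderiv_subset ℝ hne))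
      rw [h2]; rfl
    have h3 : ∫ x, G x * ⟪outwardNormal Ω x, v⟫_ℝ ∂boundaryArea Ω = 0 := by
      refine integral_eq_zero_of_ae ((ae_restrict_iff' isClosed_frontier.measurableSet).2
        (Eventually.of_forall fun x hx => ?_))
      rw [hΩ.frontier_eq] at hx
      have : G x = 0 := image_eq_zero_of_notMem_tsupport fun h => hx.2 (hGs h)
      simp [this]
    rw [h1, h3, sub_zero, abs_zero]
    exact mul_nonneg hε.le (integral_nonneg fun x => abs_nonneg _)
  · have hpf : p ∈ frontier Ω := by rw [hΩ.frontier_eq]; exact ⟨hp, hpΩ⟩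
    obtain ⟨r, hr, h⟩ := exists_ball_setIntegral_fderiv_near_inner_outwardNormal hΩ hbd hb hpf v hε
    exact ⟨Metric.ball p r, Metric.isOpen_ball, Metric.mem_ball_self hr, h⟩

/-- The divergence theorem on a bounded open set with `C¹` boundary, for a field of constant
direction `v`. -/
theorem setIntegral_fderiv_eq_integral_boundaryArea (hΩ : IsOpen Ω)
    (hbd : Bornology.IsBounded Ω) (hb : HasC1Boundary Ω) {G : E m → ℝ} (hG : ContDiff ℝ 1 G)
    (v : E m) :
    ∫ x in Ω, fderiv ℝ G x v = ∫ x, G x * ⟪outwardNormal Ω x, v⟫_ℝ ∂boundaryArea Ω := by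
  have hcn : ContinuousOn (fun x => ⟪outwardNormal Ω x, v⟫_ℝ) (frontier Ω) :=
    (continuousOn_outwardNormal hΩ hb).inner continuousOn_const
  have key : ∀ ε : ℝ, 0 < ε →
      |(∫ x in Ω, fderiv ℝ G x v) - ∫ x, G x * ⟪outwardNormal Ω x, v⟫_ℝ ∂boundaryArea Ω| ≤
        ε * ∫ x, |G x| ∂boundaryArea Ω := by
    intro ε hε
    choose! U hU hpU hGU using
      fun p (hp : p ∈ closure Ω) => exists_open_setIntegral_fderiv_near hΩ hbd hb hp v hε
    obtain ⟨T, hT, hcover⟩ := hbd.isCompact_closure.elim_nhds_subcover U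
      fun p hp => (hU p hp).mem_nhds (hpU p hp)
    obtain ⟨χ, hχ⟩ := SmoothPartitionOfUnity.exists_isSubordinate (modelWithCornersSelf ℝ (E m))
      isClosed_closure (fun i : T => U i) (fun i => hU i (hT i i.2))
      (fun x hx => by
        obtain ⟨i, hi, hxi⟩ := mem_iUnion₂.1 (hcover hx)
        exact mem_iUnion.2 ⟨⟨i, hi⟩, hxi⟩)
    have hχd : ∀ i, ContDiff ℝ 1 (fun x => χ i x) := fun i =>
      (χ i).contMDiff.contDiff.of_le (by norm_cast)
    have hsum : ∀ x ∈ closure Ω, ∑ i, χ i x = 1 := fun x hx => by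
      rw [← finsum_eq_sum_of_fintype]; exact χ.sum_eq_one hx
    have hGd : ∀ i, ContDiff ℝ 1 (fun x => χ i x * G x) := fun i => (hχd i).mul hG
    have hGi : ∀ i : T, tsupport (fun x => χ i x * G x) ⊆ U i := fun i =>
      (tsupport_mul_subset_left (f := fun x => χ i x) (g := G)).trans (hχ i)
    have hest := fun i : T => hGU i (hT i i.2) _ (hGd i) (hGi i)
    have hintΩ : ∀ i, IntegrableOn (fun x => fderiv ℝ (fun x => χ i x * G x) x v) Ω := fun i =>
      (((((hGd i).continuous_fderiv (by norm_num)).clm_apply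
        continuous_const).continuousOn.integrableOn_compact hbd.isCompact_closure)).mono_set
        subset_closure
    have hintF : ∀ i, Integrable (fun x => χ i x * G x * ⟪outwardNormal Ω x, v⟫_ℝ)
        (boundaryArea Ω) := fun i => integrable_boundaryArea_of_continuousOn hΩ hbd hb
      ((hGd i).continuous.continuousOn.mul hcn)
    have hintA : ∀ i, Integrable (fun x => |χ i x * G x|) (boundaryArea Ω) := fun i =>
      integrable_boundaryArea_of_continuousOn hΩ hbd hb (hGd i).continuous.abs.continuousOn
    have s1 : ∫ x in Ω, fderiv ℝ G x v =
        ∑ i, ∫ x in Ω, fderiv ℝ (fun x => χ i x * G x) x v := by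
      rw [← integral_finsetSum _ fun i _ => hintΩ i]
      refine setIntegral_congr_fun hΩ.measurableSet fun x hx => ?_
      have h1 : (fun x => ∑ i, χ i x * G x) =ᶠ[𝓝 x] G := by
        filter_upwards [hΩ.mem_nhds hx] with y hy
        rw [← Finset.sum_mul, hsum y (subset_closure hy), one_mul]
      have h2 := h1.fderiv_eq (𝕜 := ℝ)
      rw [fderiv_fun_sum fun i _ => ((hGd i).differentiable (by norm_num)) x] at h2
      simp only [← h2, _root_.sum_apply]
    have s2 : ∫ x, G x * ⟪outwardNormal Ω x, v⟫_ℝ ∂boundaryArea Ω =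
        ∑ i, ∫ x, χ i x * G x * ⟪outwardNormal Ω x, v⟫_ℝ ∂boundaryArea Ω := by
      rw [← integral_finsetSum _ fun i _ => hintF i]
      refine setIntegral_congr_fun isClosed_frontier.measurableSet fun x hx => ?_
      simp only [← Finset.sum_mul, hsum x (frontier_subset_closure hx), one_mul]
    -- Because the χ_i are nonnegative with sum 1, the local errors add up to ε∫|G|, whatever the
    -- number of pieces, which depends on ε.
    have s3 : ∫ x, |G x| ∂boundaryArea Ω = ∑ i, ∫ x, |χ i x * G x| ∂boundaryArea Ω := by
      rw [← integral_finsetSum _ fun i _ => hintA i]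
      refine setIntegral_congr_fun isClosed_frontier.measurableSet fun x hx => ?_
      simp only [abs_mul, abs_of_nonneg (χ.nonneg _ x), ← Finset.sum_mul,
        hsum x (frontier_subset_closure hx), one_mul]
    rw [s1, s2, s3, ← Finset.sum_sub_distrib, Finset.mul_sum]
    exact (Finset.abs_sum_le_sum_abs _ _).trans (Finset.sum_le_sum fun i _ => hest i)
  rw [← sub_eq_zero, ← abs_nonpos_iff]
  have hA : 0 ≤ ∫ x, |G x| ∂boundaryArea Ω := integral_nonneg fun x => abs_nonneg _
  refine le_of_forall_pos_le_add fun ε hε => ?_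
  -- The added 1 avoids a zero denominator.
  refine (key (ε / ((∫ x, |G x| ∂boundaryArea Ω) + 1)) (by positivity)).trans ?_
  rw [zero_add, div_mul_eq_mul_div, div_le_iff₀ (by positivity)]
  nlinarith

end Global

/-! ### Clifford algebra and the Dirac operator. -/

section Clifford

variable {m : ℕ}

/-- Multiplication of `Cl_m` as a continuous bilinear map. -/
noncomputable def clMul (m : ℕ) : Cl m →L[ℝ] Cl m →L[ℝ] Cl m :=
  (LinearMap.mul ℝ (Cl m)).toContinuousBilinearMap

@[simp] theorem clMul_apply (a b : Cl m) : clMul m a b = a * b := rfl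

/-- Clifford conjugation as a continuous linear map. -/
noncomputable def clStar (m : ℕ) : Cl m →L[ℝ] Cl m :=
  LinearMap.toContinuousLinearMap
    { toFun := star, map_add' := star_add, map_smul' := CliffordAlgebra.star_smul }

/-- The embedding of vectors as a continuous linear map. -/
noncomputable def vecL (m : ℕ) : E m →L[ℝ] Cl m :=
  LinearMap.toContinuousLinearMap (CliffordAlgebra.ι (cliffordForm m))

@[simp] theorem vecL_apply (x : E m) : vecL m x = vec x := rfl

/-- The standard basis vectors. -/
noncomputable abbrev e (j : Fin m) : E m := EuclideanSpace.single j (1 : ℝ)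

theorem star_vec (x : E m) : star (vec x) = -vec x := CliffordAlgebra.star_ι x

theorem vec_mul_vec_add_swap (a b : E m) :
    vec a * vec b + vec b * vec a = (-(2 * ⟪a, b⟫_ℝ)) • (1 : Cl m) := by
  rw [vec, vec, CliffordAlgebra.ι_mul_ι_add_swap, Algebra.algebraMap_eq_smul_one]
  congr 1
  simp only [cliffordForm, QuadraticMap.polar, _root_.neg_apply,
    LinearMap.BilinMap.toQuadraticMap_apply, innerₗ_apply_apply, inner_add_left, inner_add_right,
    real_inner_comm a b]
  ring

theorem inner_e (i j : Fin m) : ⟪e i, e j⟫_ℝ = if i = j then 1 else 0 := by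
  simp [EuclideanSpace.inner_single_left, PiLp.single_apply]

theorem vec_e_mul_vec_e_self (i : Fin m) : vec (e i) * vec (e i) = (-1 : Cl m) := by
  have h := vec_mul_vec_add_swap (e i) (e i)
  rw [inner_e, if_pos rfl, ← two_smul ℝ (vec (e i) * vec (e i))] at h
  have h2 := congrArg (fun z => (2⁻¹ : ℝ) • z) h
  simpa [smul_smul] using h2

theorem sum_smul_e (x : E m) : ∑ j, x j • e j = x := by
  have h := (EuclideanSpace.basisFun (Fin m) ℝ).sum_repr x
  simpa using h

theorem vec_eq_sum (x : E m) : vec x = ∑ j, x j • vec (e j) := by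
  conv_lhs => rw [← vecL_apply, ← sum_smul_e x, map_sum]
  simp

variable {X : Type*} [NormedAddCommGroup X] [NormedSpace ℝ X]

theorem contDiff_cl_mul {n : WithTop ℕ∞} {F G : X → Cl m} (hF : ContDiff ℝ n F)
    (hG : ContDiff ℝ n G) : ContDiff ℝ n fun x => F x * G x :=
  (clMul m).isBoundedBilinearMap.contDiff.comp (hF.prodMk hG)

theorem contDiff_cl_star {n : WithTop ℕ∞} {F : X → Cl m} (hF : ContDiff ℝ n F) :
    ContDiff ℝ n fun x => star (F x) :=
  (clStar m).contDiff.comp hF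

theorem continuous_cl_mul {Y : Type*} [TopologicalSpace Y] {F G : Y → Cl m} (hF : Continuous F)
    (hG : Continuous G) : Continuous fun x => F x * G x :=
  ((clMul m).continuous.comp hF).clm_apply hG

theorem continuous_cl_star {Y : Type*} [TopologicalSpace Y] {F : Y → Cl m} (hF : Continuous F) :
    Continuous fun x => star (F x) :=
  (clStar m).continuous.comp hF

theorem contDiff_vec {n : WithTop ℕ∞} : ContDiff ℝ n (vec : E m → Cl m) := (vecL m).contDiff

theorem fderiv_cl_mul {F G : X → Cl m} {x : X} (hF : DifferentiableAt ℝ F x)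
    (hG : DifferentiableAt ℝ G x) (v : X) :
    fderiv ℝ (fun y => F y * G y) x v = fderiv ℝ F x v * G x + F x * fderiv ℝ G x v := by
  have h := ((clMul m).hasFDerivAt_of_bilinear hF.hasFDerivAt hG.hasFDerivAt).fderiv
  simp only [clMul_apply] at h
  rw [h]
  simp [add_comm]

theorem fderiv_cl_const_mul {G : X → Cl m} {x : X} (a : Cl m) (hG : DifferentiableAt ℝ G x)
    (v : X) : fderiv ℝ (fun y => a * G y) x v = a * fderiv ℝ G x v := by
  rw [fderiv_cl_mul (differentiableAt_const a) hG]
  simp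

theorem fderiv_cl_star {F : X → Cl m} {x : X} (hF : DifferentiableAt ℝ F x) (v : X) :
    fderiv ℝ (fun y => star (F y)) x v = star (fderiv ℝ F x v) := by
  have h := ((clStar m).hasFDerivAt.comp x hF.hasFDerivAt).fderiv
  have h2 : (fun y => star (F y)) = ⇑(clStar m) ∘ F := rfl
  rw [h2, h]; rfl

theorem fderiv_vec (x v : E m) : fderiv ℝ (vec : E m → Cl m) x v = vec v := by
  have h := (vecL m).fderiv (x := x)
  have h2 : (vec : E m → Cl m) = ⇑(vecL m) := rfl
  rw [h2, h]

theorem contDiff_fderiv_apply {F : E m → Cl m} (hF : ContDiff ℝ ∞ F) (v : E m) :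
    ContDiff ℝ ∞ fun x => fderiv ℝ F x v :=
  (hF.fderiv_right (m := ∞) le_rfl).clm_apply contDiff_const

theorem contDiff_dirac {F : E m → Cl m} (hF : ContDiff ℝ ∞ F) : ContDiff ℝ ∞ (dirac F) :=
  ContDiff.sum fun j _ => contDiff_cl_mul contDiff_const (contDiff_fderiv_apply hF (e j))

theorem dirac_add {F G : E m → Cl m} {x : E m} (hF : DifferentiableAt ℝ F x)
    (hG : DifferentiableAt ℝ G x) :
    dirac (fun y => F y + G y) x = dirac F x + dirac G x := by
  simp only [dirac, ← Finset.sum_add_distrib]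
  refine Finset.sum_congr rfl fun j _ => ?_
  rw [fderiv_fun_add hF hG, _root_.add_apply, mul_add]

theorem dirac_sub {F G : E m → Cl m} {x : E m} (hF : DifferentiableAt ℝ F x)
    (hG : DifferentiableAt ℝ G x) :
    dirac (fun y => F y - G y) x = dirac F x - dirac G x := by
  simp only [dirac, ← Finset.sum_sub_distrib]
  refine Finset.sum_congr rfl fun j _ => ?_
  rw [fderiv_fun_sub hF hG, _root_.sub_apply, mul_sub]

theorem dirac_const_smul {F : E m → Cl m} {x : E m} (c : ℝ) (hF : DifferentiableAt ℝ F x) :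
    dirac (fun y => c • F y) x = c • dirac F x := by
  simp only [dirac, Finset.smul_sum]
  refine Finset.sum_congr rfl fun j _ => ?_
  rw [fderiv_fun_const_smul hF, _root_.smul_apply, mul_smul_comm]

theorem fderiv_dirac {F : E m → Cl m} (hF : ContDiff ℝ ∞ F) (x v : E m) :
    fderiv ℝ (dirac F) x v = ∑ j, vec (e j) * fderiv ℝ (fun y => fderiv ℝ F y (e j)) x v := by
  have hd : ∀ j, DifferentiableAt ℝ (fun y => fderiv ℝ F y (e j)) x := fun j =>
    (contDiff_fderiv_apply hF (e j)).differentiable (by simp) x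
  have h1 : dirac F = fun y => ∑ j, vec (e j) * fderiv ℝ F y (e j) := rfl
  rw [h1, fderiv_fun_sum fun j _ =>
    (contDiff_cl_mul contDiff_const (contDiff_fderiv_apply hF (e j))).differentiable
      (n := ∞) (by simp) x, _root_.sum_apply]
  exact Finset.sum_congr rfl fun j _ => fderiv_cl_const_mul _ (hd j) v

theorem fderiv_fderiv_apply_comm {F : E m → Cl m} (hF : ContDiff ℝ ∞ F) (x a b : E m) :
    fderiv ℝ (fun y => fderiv ℝ F y a) x b = fderiv ℝ (fun y => fderiv ℝ F y b) x a := by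
  have hd : DifferentiableAt ℝ (fderiv ℝ F) x :=
    (hF.fderiv_right (m := ∞) le_rfl).differentiable (by simp) x
  have hs : IsSymmSndFDerivAt ℝ F x :=
    hF.contDiffAt.isSymmSndFDerivAt (by
      rw [minSmoothness_of_isRCLikeNormedField]; exact ENat.LEInfty.out)
  have key : ∀ a b, fderiv ℝ (fun y => fderiv ℝ F y a) x b = fderiv ℝ (fderiv ℝ F) x b a := by
    intro a b
    rw [fderiv_clm_apply hd (differentiableAt_const a)]
    simp
  rw [key, key, hs.eq]

/-- The sum of the unmixed second partial derivatives. -/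
noncomputable def lap (F : E m → Cl m) (x : E m) : Cl m :=
  ∑ i, fderiv ℝ (fun y => fderiv ℝ F y (e i)) x (e i)

theorem lap_eq_laplacian {F : E m → Cl m} (hF : ContDiff ℝ ∞ F) (x : E m) :
    lap F x = Laplacian.laplacian F x := by
  have hd : DifferentiableAt ℝ (fderiv ℝ F) x :=
    (hF.fderiv_right (m := ∞) le_rfl).differentiable (by simp) x
  rw [InnerProductSpace.laplacian_eq_iteratedFDeriv_orthonormalBasis F
    (EuclideanSpace.basisFun (Fin m) ℝ), lap]
  refine Finset.sum_congr rfl fun i _ => ?_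
  rw [iteratedFDeriv_two_apply, fderiv_clm_apply hd (differentiableAt_const _)]
  simp

/-- Second derivatives are symmetric, so twice the double sum involves only e_i e_j + e_j e_i =
-2δ_ij. -/
theorem dirac_dirac {F : E m → Cl m} (hF : ContDiff ℝ ∞ F) (x : E m) :
    dirac (dirac F) x = -lap F x := by
  set H : Fin m → Fin m → Cl m := fun i j => fderiv ℝ (fun y => fderiv ℝ F y (e j)) x (e i)
    with hH
  have hsymm : ∀ i j, H i j = H j i := fun i j => fderiv_fderiv_apply_comm hF x _ _
  have h1 : dirac (dirac F) x = ∑ i, ∑ j, vec (e i) * vec (e j) * H i j := by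
    simp only [dirac.eq_1 (dirac F), fderiv_dirac hF, Finset.mul_sum, mul_assoc, hH]
  have h2 : dirac (dirac F) x = ∑ i, ∑ j, vec (e j) * vec (e i) * H i j := by
    rw [h1, Finset.sum_comm]
    exact Finset.sum_congr rfl fun i _ => Finset.sum_congr rfl fun j _ => by rw [hsymm]
  have h3 : dirac (dirac F) x + dirac (dirac F) x = -lap F x + -lap F x := by
    conv_lhs => rw [h1]
    conv_lhs => arg 2; rw [← h1, h2]
    rw [← Finset.sum_add_distrib, lap, ← Finset.sum_neg_distrib, ← Finset.sum_add_distrib]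
    refine Finset.sum_congr rfl fun i _ => ?_
    rw [← Finset.sum_add_distrib]
    simp only [← add_mul, vec_mul_vec_add_swap, inner_e]
    rw [Finset.sum_eq_single i]
    · simp only [if_true, mul_one, hH, smul_mul_assoc, one_mul]
      module
    · intro j _ hj
      simp [Ne.symm hj]
    · simp
  rw [← two_smul ℝ, ← two_smul ℝ] at h3
  exact smul_right_injective _ (two_ne_zero (α := ℝ)) h3

/-- Here e_j² = -1 gives -m q, and e_j u = -u e_j - 2u_j gives the other terms; `fderiv ℝ q u u` is
the Euler operator. -/
theorem dirac_vec_mul {q : E m → Cl m} {u : E m} (hq : DifferentiableAt ℝ q u) :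
    dirac (fun w => vec w * q w) u =
      -((m : ℝ) • q u) - (2 : ℝ) • fderiv ℝ q u u - vec u * dirac q u := by
  have hv : DifferentiableAt ℝ (vec : E m → Cl m) u := (vecL m).differentiableAt
  have h1 : dirac (fun w => vec w * q w) u =
      ∑ j, (vec (e j) * vec (e j) * q u + vec (e j) * vec u * fderiv ℝ q u (e j)) := by
    refine Finset.sum_congr rfl fun j _ => ?_
    rw [fderiv_cl_mul hv hq, fderiv_vec, mul_add, mul_assoc, mul_assoc]
  have h2 : ∀ j, vec (e j) * vec u * fderiv ℝ q u (e j) =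
      -((2 * u j) • fderiv ℝ q u (e j)) - vec u * (vec (e j) * fderiv ℝ q u (e j)) := by
    intro j
    have h3 := vec_mul_vec_add_swap (e j) u
    rw [EuclideanSpace.inner_single_left] at h3
    simp only [map_one, one_mul] at h3
    rw [eq_sub_of_add_eq h3, sub_mul, smul_mul_assoc, one_mul, neg_smul, mul_assoc]
  have h4 : fderiv ℝ q u u = ∑ j, u j • fderiv ℝ q u (e j) := by
    conv_lhs => rw [← sum_smul_e u]
    rw [map_sum]
    simp only [map_smul, sum_smul_e]
  rw [h1, Finset.sum_add_distrib]
  simp only [h2, vec_e_mul_vec_e_self, Finset.sum_sub_distrib, Finset.sum_neg_distrib]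
  rw [h4, dirac, Finset.mul_sum, Finset.smul_sum]
  simp only [mul_smul, neg_mul, one_mul, Finset.sum_const, Finset.card_univ, Fintype.card_fin,
    Nat.cast_smul_eq_nsmul, smul_neg]
  abel

end Clifford

/-! ### Homogeneous harmonics and the Almansi–Fischer projections. -/

section Projections

variable {m : ℕ}

/-- Positive homogeneity of degree `k`. -/
def IsHomogeneousFun (k : ℕ) (p : E m → Cl m) : Prop :=
  ∀ t : ℝ, 0 < t → ∀ u, p (t • u) = t ^ k • p u

/-- Smooth functions, homogeneous of degree `k`, annihilated by the Dirac operator. -/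
structure IsMonogenic (k : ℕ) (p : E m → Cl m) : Prop where
  smooth : ContDiff ℝ ∞ p
  homog : IsHomogeneousFun k p
  dirac_eq_zero : ∀ u, dirac p u = 0

/-- Smooth functions, homogeneous of degree `k`, annihilated by the Laplace operator. -/
structure IsHarmonicHomog (k : ℕ) (p : E m → Cl m) : Prop where
  smooth : ContDiff ℝ ∞ p
  homog : IsHomogeneousFun k p
  lap_eq_zero : ∀ u, lap p u = 0

/-- The only consequence of polynomiality that is needed; the later arguments use smooth positively
homogeneous functions. -/
theorem isHomogeneousFun_of_mem_homPoly {k : ℕ} {p : E m → Cl m} (hp : p ∈ homPoly m k) :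
    IsHomogeneousFun k p := by
  intro t _ u
  induction hp using Submodule.span_induction with
  | mem p hp =>
    obtain ⟨q, hq, a, rfl⟩ := hp
    have h : MvPolynomial.eval (fun i => (t • u) i) q =
        t ^ k * MvPolynomial.eval (fun i => u i) q := by
      rw [MvPolynomial.eval_eq, MvPolynomial.eval_eq, Finset.mul_sum]
      refine Finset.sum_congr rfl fun d hd => ?_
      have hdeg : ∑ i ∈ d.support, d i = k := by
        have := hq (MvPolynomial.mem_support_iff.1 hd)
        rwa [Finsupp.weight_apply, Finsupp.sum, Finset.sum_congr rfl
          (fun i _ => show d i • (1 : Fin m → ℕ) i = d i by simp)] at this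
      simp only [PiLp.smul_apply, smul_eq_mul, mul_pow, Finset.prod_mul_distrib,
        Finset.prod_pow_eq_pow_sum, hdeg]
      ring
    simp only [h, mul_smul]
  | zero => simp
  | add p q _ _ hp hq => simp [hp, hq]
  | smul c p _ hp => simp [hp, smul_comm c]

/-- Euler's identity, from differentiating p(tu) = t^k p(u) at t = 1. -/
theorem IsHomogeneousFun.fderiv_self {k : ℕ} {p : E m → Cl m} (h : IsHomogeneousFun k p)
    (hp : Differentiable ℝ p) (u : E m) : fderiv ℝ p u u = (k : ℝ) • p u := by
  have h1 : HasDerivAt (fun t : ℝ => p (t • u)) (fderiv ℝ p u u) 1 := by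
    have h0 := (hasDerivAt_id (1 : ℝ)).smul_const u
    rw [one_smul] at h0
    have h3 : HasFDerivAt p (fderiv ℝ p u) ((1 : ℝ) • u) := by
      rw [one_smul]; exact (hp u).hasFDerivAt
    exact h3.comp_hasDerivAt (1 : ℝ) h0
  have h2 : HasDerivAt (fun t : ℝ => t ^ k • p u) ((k : ℝ) • p u) 1 := by
    have := ((hasDerivAt_pow k (1 : ℝ))).smul_const (p u)
    simpa using this
  refine h1.unique (h2.congr_of_eventuallyEq ?_)
  filter_upwards [lt_mem_nhds one_pos] with t ht
  exact h t ht u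

theorem IsHomogeneousFun.fderiv_apply {k : ℕ} {p : E m → Cl m} (hk : 1 ≤ k)
    (h : IsHomogeneousFun k p) (hp : Differentiable ℝ p) (v : E m) :
    IsHomogeneousFun (k - 1) fun u => fderiv ℝ p u v := by
  intro t ht u
  have h1 : HasFDerivAt (fun w => p (t • w)) (t • fderiv ℝ p (t • u)) u := by
    have h0 : HasFDerivAt (fun w : E m => t • w) (t • ContinuousLinearMap.id ℝ (E m)) u :=
      (hasFDerivAt_id u).const_smul t
    have := ((hp (t • u)).hasFDerivAt).comp u h0
    refine this.congr_fderiv ?_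
    ext w; simp
  have h2 : HasFDerivAt (fun w => p (t • w)) (t ^ k • fderiv ℝ p u) u := by
    have : (fun w => p (t • w)) = fun w => t ^ k • p w := funext fun w => h t ht w
    rw [this]
    exact (hp u).hasFDerivAt.const_smul (t ^ k)
  have h3 := congrArg (fun L : E m →L[ℝ] Cl m => t⁻¹ • L v) (h1.unique h2)
  simp only [_root_.smul_apply, smul_smul, inv_mul_cancel₀ ht.ne', one_smul] at h3
  change fderiv ℝ p (t • u) v = _
  rw [h3]
  congr 1
  obtain ⟨j, rfl⟩ : ∃ j, k = j + 1 := ⟨k - 1, by omega⟩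
  rw [pow_succ', inv_mul_cancel_left₀ ht.ne', Nat.add_sub_cancel]

theorem IsHomogeneousFun.dirac {k : ℕ} {p : E m → Cl m} (hk : 1 ≤ k)
    (h : IsHomogeneousFun k p) (hp : Differentiable ℝ p) :
    IsHomogeneousFun (k - 1) (HigherSpin.dirac p) := by
  intro t ht u
  simp only [HigherSpin.dirac, Finset.smul_sum]
  refine Finset.sum_congr rfl fun j _ => ?_
  have h1 : fderiv ℝ p (t • u) (e j) = t ^ (k - 1) • fderiv ℝ p u (e j) :=
    h.fderiv_apply hk hp (e j) t ht u
  rw [h1, mul_smul_comm]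

theorem IsHarmonicHomog.isMonogenic_dirac {k : ℕ} {p : E m → Cl m} (hk : 1 ≤ k)
    (hp : IsHarmonicHomog k p) : IsMonogenic (k - 1) (dirac p) where
  smooth := contDiff_dirac hp.smooth
  homog := hp.homog.dirac hk (hp.smooth.differentiable (by simp))
  dirac_eq_zero u := by rw [dirac_dirac hp.smooth, hp.lap_eq_zero, neg_zero]

theorem IsMonogenic.isHarmonicHomog {k : ℕ} {p : E m → Cl m} (hp : IsMonogenic k p) :
    IsHarmonicHomog k p where
  smooth := hp.smooth
  homog := hp.homog
  lap_eq_zero u := by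
    have h := dirac_dirac hp.smooth u
    have h0 : dirac p = fun _ => 0 := funext hp.dirac_eq_zero
    rw [h0] at h
    simpa [dirac] using h.symm

theorem lap_sub {p q : E m → Cl m} (hp : ContDiff ℝ ∞ p) (hq : ContDiff ℝ ∞ q) (u : E m) :
    lap (fun w => p w - q w) u = lap p u - lap q u := by
  have hd : Differentiable ℝ p := hp.differentiable (by simp)
  have hd' : Differentiable ℝ q := hq.differentiable (by simp)
  have h1 := dirac_dirac (hp.sub hq) u
  have h2 : dirac (fun w => p w - q w) = fun w => dirac p w - dirac q w :=
    funext fun w => dirac_sub (hd w) (hd' w)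
  rw [h2, dirac_sub ((contDiff_dirac hp).differentiable (by simp) u)
    ((contDiff_dirac hq).differentiable (by simp) u), dirac_dirac hp, dirac_dirac hq] at h1
  rw [← neg_inj, ← h1]
  abel

theorem IsHarmonicHomog.sub {k : ℕ} {p q : E m → Cl m} (hp : IsHarmonicHomog k p)
    (hq : IsHarmonicHomog k q) : IsHarmonicHomog k fun u => p u - q u where
  smooth := hp.smooth.sub hq.smooth
  homog t ht u := by simp only [hp.homog t ht u, hq.homog t ht u, smul_sub]
  lap_eq_zero u := by rw [lap_sub hp.smooth hq.smooth, hp.lap_eq_zero, hq.lap_eq_zero, sub_zero]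

/-- The projection `P_k^+` for functions of the variable `u` alone. -/
noncomputable def projPlus (k : ℕ) (p : E m → Cl m) : E m → Cl m :=
  fun u => p u + ((m : ℝ) + 2 * k - 2)⁻¹ • (vec u * dirac p u)

theorem contDiff_projPlus {k : ℕ} {p : E m → Cl m} (hp : ContDiff ℝ ∞ p) :
    ContDiff ℝ ∞ (projPlus k p) :=
  hp.add ((contDiff_cl_mul contDiff_vec (contDiff_dirac hp)).const_smul
    (((m : ℝ) + 2 * k - 2)⁻¹))

/-- As Dp is monogenic of degree k - 1, D(u Dp) = -(m + 2(k-1)) Dp, and the normalizing constant in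
P⁺ is exactly what cancels Dp. -/
theorem IsHarmonicHomog.isMonogenic_projPlus {k : ℕ} {p : E m → Cl m} (hm : 1 ≤ m) (hk : 1 ≤ k)
    (hp : IsHarmonicHomog k p) : IsMonogenic k (projPlus k p) where
  smooth := contDiff_projPlus hp.smooth
  homog t ht u := by
    have h1 := (hp.isMonogenic_dirac hk).homog t ht u
    have h2 : vec (t • u) = t • vec u := map_smul (CliffordAlgebra.ι (cliffordForm m)) t u
    obtain ⟨j, rfl⟩ : ∃ j, k = j + 1 := ⟨k - 1, by omega⟩
    rw [Nat.add_sub_cancel] at h1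
    rw [projPlus, hp.homog t ht u, h1, h2, smul_mul_smul_comm, ← pow_succ', smul_comm _ (t ^ (j + 1)),
      ← smul_add, projPlus]
  dirac_eq_zero u := by
    have hq := hp.isMonogenic_dirac hk
    have hqd : Differentiable ℝ (dirac p) := hq.smooth.differentiable (by simp)
    have hud : Differentiable ℝ fun w => vec w * dirac p w :=
      (contDiff_cl_mul contDiff_vec hq.smooth).differentiable (n := ∞) (by simp)
    have hc : (m : ℝ) + 2 * k - 2 ≠ 0 := by
      have h1 : (1 : ℝ) ≤ m := by exact_mod_cast hm
      have h2 : (1 : ℝ) ≤ k := by exact_mod_cast hk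
      exact (by linarith : (0 : ℝ) < m + 2 * k - 2).ne'
    have h1 : dirac (projPlus k p) u = dirac p u +
        ((m : ℝ) + 2 * k - 2)⁻¹ • dirac (fun w => vec w * dirac p w) u := by
      rw [← dirac_const_smul _ (hud u)]
      exact dirac_add (hp.smooth.differentiable (by simp) u) ((hud u).fun_const_smul _)
    rw [h1, dirac_vec_mul (hqd u), hq.dirac_eq_zero, hq.homog.fderiv_self hqd, mul_zero, sub_zero,
      smul_smul, ← neg_smul, ← sub_smul, smul_smul, Nat.cast_sub hk, Nat.cast_one]
    have h2 : ((m : ℝ) + 2 * k - 2)⁻¹ * (-(m : ℝ) - 2 * ((k : ℝ) - 1)) = -1 := by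
      field_simp
      ring
    rw [h2, neg_one_smul, add_neg_cancel]

theorem projPlus_eq_self {k : ℕ} {p : E m → Cl m} (hp : ∀ u, dirac p u = 0) :
    projPlus k p = p := by
  funext u
  simp [projPlus, hp u]

theorem sub_projPlus_apply (k : ℕ) (p : E m → Cl m) (u : E m) :
    p u - projPlus k p u = -(((m : ℝ) + 2 * k - 2)⁻¹ • (vec u * dirac p u)) := by
  rw [projPlus, sub_add_cancel_left]

/-- P⁺p is monogenic, so p and p - P⁺p have the same image under D, hence the same correction term.
-/
theorem IsHarmonicHomog.projPlus_sub_projPlus {k : ℕ} {p : E m → Cl m} (hm : 1 ≤ m) (hk : 1 ≤ k)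
    (hp : IsHarmonicHomog k p) : projPlus k (fun u => p u - projPlus k p u) = fun _ => 0 := by
  have hM := hp.isMonogenic_projPlus hm hk
  funext u
  have h1 : dirac (fun u => p u - projPlus k p u) u = dirac p u := by
    rw [dirac_sub (hp.smooth.differentiable (by simp) u) (hM.smooth.differentiable (by simp) u),
      hM.dirac_eq_zero, sub_zero]
  rw [projPlus, h1, sub_projPlus_apply, neg_add_cancel]

end Projections

/-! ### Smooth functions of two vector variables. -/

section Fields

variable {m : ℕ}

/-- Joint smoothness of a field. -/
abbrev IsSmoothField (f : Field m) : Prop := ContDiff ℝ ∞ fun z : E m × E m => f z.1 z.2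

theorem IsSmoothField.right {f : Field m} (hf : IsSmoothField f) (x : E m) : ContDiff ℝ ∞ (f x) :=
  hf.comp (contDiff_const.prodMk contDiff_id : ContDiff ℝ ∞ fun u : E m => (x, u))

theorem IsSmoothField.left {f : Field m} (hf : IsSmoothField f) (u : E m) :
    ContDiff ℝ ∞ fun x => f x u :=
  hf.comp (contDiff_id.prodMk contDiff_const : ContDiff ℝ ∞ fun x : E m => (x, u))

theorem IsSmoothField.fderiv_right {f : Field m} (hf : IsSmoothField f) (v : E m) :
    IsSmoothField fun x u => fderiv ℝ (f x) u v := by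
  have h : ContDiff ℝ ∞ (Function.uncurry fun (z : E m × E m) (w : E m) => f z.1 w) :=
    hf.comp ((contDiff_fst.comp contDiff_fst).prodMk contDiff_snd :
      ContDiff ℝ ∞ fun y : (E m × E m) × E m => (y.1.1, y.2))
  exact (ContDiff.fderiv h contDiff_snd (n := ∞) le_rfl).clm_apply contDiff_const

theorem IsSmoothField.fderiv_left {f : Field m} (hf : IsSmoothField f) (v : E m) :
    IsSmoothField fun x u => fderiv ℝ (fun y => f y u) x v := by
  have h : ContDiff ℝ ∞ (Function.uncurry fun (z : E m × E m) (y : E m) => f y z.2) :=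
    hf.comp (contDiff_snd.prodMk (contDiff_snd.comp contDiff_fst) :
      ContDiff ℝ ∞ fun y : (E m × E m) × E m => (y.2, y.1.2))
  exact (ContDiff.fderiv h contDiff_fst (n := ∞) le_rfl).clm_apply contDiff_const

theorem IsSmoothField.projPlus {f : Field m} (hf : IsSmoothField f) (k : ℕ) :
    IsSmoothField fun x => projPlus k (f x) := by
  have h1 : IsSmoothField fun x => dirac (f x) :=
    ContDiff.sum fun j _ => contDiff_cl_mul contDiff_const (hf.fderiv_right (e j))
  exact hf.add ((contDiff_cl_mul (contDiff_vec.comp contDiff_snd) h1).const_smul _)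

theorem IsSmoothField.diracX {f : Field m} (hf : IsSmoothField f) : IsSmoothField (diracX f) := by
  have h : ∀ j : Fin m, ContDiff ℝ ∞ fun z : E m × E m =>
      vec (e j) * fderiv ℝ (fun y => f y z.2) z.1 (e j) :=
    fun j => contDiff_cl_mul contDiff_const (hf.fderiv_left (e j))
  change ContDiff ℝ ∞ fun z : E m × E m =>
    ∑ j, vec (e j) * fderiv ℝ (fun y => f y z.2) z.1 (e j)
  exact ContDiff.sum fun j _ => h j

/-- Symmetry of the second derivative on the product space, in the directions (a,0) and (0,b). -/
theorem IsSmoothField.fderiv_comm {f : Field m} (hf : IsSmoothField f) (x u a b : E m) :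
    fderiv ℝ (fun w => fderiv ℝ (fun y => f y w) x a) u b =
      fderiv ℝ (fun y => fderiv ℝ (f y) u b) x a := by
  set Φ : E m × E m → Cl m := fun z => f z.1 z.2 with hΦ
  have hΦd : Differentiable ℝ Φ := hf.differentiable (by simp)
  have hΦ'd : Differentiable ℝ (fderiv ℝ Φ) :=
    (ContDiff.fderiv_right (m := ∞) hf le_rfl).differentiable (by simp)
  have hs : IsSymmSndFDerivAt ℝ Φ (x, u) := hf.contDiffAt.isSymmSndFDerivAt (by
    rw [minSmoothness_of_isRCLikeNormedField]; exact ENat.LEInfty.out)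
  have hl : ∀ x w : E m, HasFDerivAt (fun y => (y, w))
      (ContinuousLinearMap.inl ℝ (E m) (E m)) x := fun x w => hasFDerivAt_prodMk_left x w
  have hr : ∀ x w : E m, HasFDerivAt (fun y => (x, y))
      (ContinuousLinearMap.inr ℝ (E m) (E m)) w := fun x w => hasFDerivAt_prodMk_right x w
  have k1 : ∀ w, fderiv ℝ (fun y => f y w) x a = fderiv ℝ Φ (x, w) (a, 0) := fun w => by
    have := ((hΦd (x, w)).hasFDerivAt.comp x (hl x w)).fderiv
    have h2 : (fun y => f y w) = Φ ∘ fun y => (y, w) := rfl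
    rw [h2, this]; simp
  have k2 : ∀ y, fderiv ℝ (f y) u b = fderiv ℝ Φ (y, u) (0, b) := fun y => by
    have := ((hΦd (y, u)).hasFDerivAt.comp u (hr y u)).fderiv
    have h2 : f y = Φ ∘ fun w => (y, w) := rfl
    rw [h2, this]; simp
  simp only [k1, k2]
  have l1 : HasFDerivAt (fun w => fderiv ℝ Φ (x, w) (a, 0))
      (((fderiv ℝ (fderiv ℝ Φ) (x, u)).comp (ContinuousLinearMap.inr ℝ (E m) (E m))).flip (a, 0))
      u := by
    have := ((hΦ'd (x, u)).hasFDerivAt.comp u (hr x u)).clm_apply (hasFDerivAt_const (a, 0) u)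
    simpa using this
  have l2 : HasFDerivAt (fun y => fderiv ℝ Φ (y, u) (0, b))
      (((fderiv ℝ (fderiv ℝ Φ) (x, u)).comp (ContinuousLinearMap.inl ℝ (E m) (E m))).flip (0, b))
      x := by
    have := ((hΦ'd (x, u)).hasFDerivAt.comp x (hl x u)).clm_apply (hasFDerivAt_const (0, b) x)
    simpa using this
  rw [l1.fderiv, l2.fderiv]
  simp [hs.eq (0, b) (a, 0)]

/-- The Dirac operator in `x` preserves harmonicity and homogeneity in `u`. -/
theorem isHarmonicHomog_diracX {k : ℕ} {f : Field m} (hf : IsSmoothField f)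
    (hk : ∀ x, IsHarmonicHomog k (f x)) (x : E m) : IsHarmonicHomog k (diracX f x) where
  smooth := hf.diracX.right x
  homog t ht u := by
    have h1 : (fun y => f y (t • u)) = fun y => t ^ k • f y u :=
      funext fun y => (hk y).homog t ht u
    have h2 : Differentiable ℝ fun y => f y u := (hf.left u).differentiable (by simp)
    simp only [diracX]
    rw [h1, dirac_const_smul _ (h2 x)]
  lap_eq_zero u := by
    have hx : ∀ j, IsSmoothField fun x u => fderiv ℝ (fun y => f y u) x (e j) := fun j =>
      hf.fderiv_left (e j)
    have hu : ∀ i, IsSmoothField fun x u => fderiv ℝ (f x) u (e i) := fun i =>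
      hf.fderiv_right (e i)
    have hdiff : ∀ {F : Field m}, IsSmoothField F → ∀ x, Differentiable ℝ (F x) :=
      fun hF x => (hF.right x).differentiable (by simp)
    -- Commuting each ∂_{u_i} past D_x twice gives Δ_u D_x f = D_x Δ_u f = 0.
    have step : ∀ i w, fderiv ℝ (diracX f x) w (e i) =
        ∑ j, vec (e j) * fderiv ℝ (fun y => fderiv ℝ (f y) w (e i)) x (e j) := by
      intro i w
      have h0 : diracX f x = fun w => ∑ j, vec (e j) * fderiv ℝ (fun y => f y w) x (e j) := rfl
      rw [h0, fderiv_fun_sum fun j _ =>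
        (contDiff_cl_mul contDiff_const ((hx j).right x)).differentiable (n := ∞) (by simp) w,
        _root_.sum_apply]
      refine Finset.sum_congr rfl fun j _ => ?_
      rw [fderiv_cl_const_mul _ (hdiff (hx j) x w), hf.fderiv_comm]
    have step2 : ∀ i, fderiv ℝ (fun w => fderiv ℝ (diracX f x) w (e i)) u (e i) =
        ∑ j, vec (e j) *
          fderiv ℝ (fun y => fderiv ℝ (fun w => fderiv ℝ (f y) w (e i)) u (e i)) x (e j) := by
      intro i
      have hxu : ∀ j, IsSmoothField fun x u =>
          fderiv ℝ (fun y => fderiv ℝ (f y) u (e i)) x (e j) := fun j => (hu i).fderiv_left (e j)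
      rw [funext (step i), fderiv_fun_sum fun j _ =>
        (contDiff_cl_mul contDiff_const ((hxu j).right x)).differentiable (n := ∞) (by simp) u,
        _root_.sum_apply]
      refine Finset.sum_congr rfl fun j _ => ?_
      rw [fderiv_cl_const_mul _ (hdiff (hxu j) x u), (hu i).fderiv_comm]
    rw [lap]
    simp only [step2]
    rw [Finset.sum_comm]
    refine Finset.sum_eq_zero fun j _ => ?_
    rw [← Finset.mul_sum]
    have h3 : ∑ i, fderiv ℝ (fun y => fderiv ℝ (fun w => fderiv ℝ (f y) w (e i)) u (e i)) x (e j)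
        = fderiv ℝ (fun y => lap (f y) u) x (e j) := by
      have h4 : (fun y => lap (f y) u) =
          fun y => ∑ i, fderiv ℝ (fun w => fderiv ℝ (f y) w (e i)) u (e i) := rfl
      rw [h4, fderiv_fun_sum fun i _ => ((((hu i).fderiv_right (e i)).left u).differentiable
        (n := ∞) (by simp) x), _root_.sum_apply]
    have h5 : (fun y => lap (f y) u) = fun _ => 0 := funext fun y => (hk y).lap_eq_zero u
    rw [h3, h5]
    simp

end Fields

/-! ### Gaussian integrals of homogeneous functions in polar coordinates. -/

section GaussianPolar

variable {m : ℕ}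

theorem integral_volumeIoiPow (n : ℕ) (f : ℝ → ℝ) :
    ∫ x : Ioi (0 : ℝ), f x ∂Measure.volumeIoiPow n = ∫ y in Ioi (0 : ℝ), y ^ n * f y := by
  simp only [Measure.volumeIoiPow, ENNReal.ofReal]
  rw [integral_withDensity_eq_integral_smul,
    integral_subtype_comap measurableSet_Ioi fun a ↦ Real.toNNReal (a ^ n) • f a]
  · refine setIntegral_congr_fun measurableSet_Ioi fun x hx => ?_
    simp only [NNReal.smul_def, Real.coe_toNNReal _ (pow_nonneg hx.out.le _), smul_eq_mul]
  · exact (measurable_subtype_coe.pow_const _).real_toNNReal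

theorem integral_pow_mul_gaussian_pos (n : ℕ) :
    0 < ∫ y in Ioi (0 : ℝ), y ^ n * Real.exp (-y ^ 2) := by
  have h := integral_rpow_mul_exp_neg_rpow (p := 2) (q := n) two_pos
    (by linarith [(Nat.cast_nonneg n : (0 : ℝ) ≤ n)])
  have h2 : ∫ y in Ioi (0 : ℝ), y ^ n * Real.exp (-y ^ 2) =
      ∫ y in Ioi (0 : ℝ), y ^ (n : ℝ) * Real.exp (-y ^ (2 : ℝ)) := by
    refine setIntegral_congr_fun measurableSet_Ioi fun y _ => ?_
    simp only [Real.rpow_natCast, Real.rpow_two]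
  rw [h2, h]
  have : 0 < ((n : ℝ) + 1) / 2 := by positivity
  exact mul_pos (by norm_num) (Real.Gamma_pos_of_pos this)

theorem integrable_norm_pow_mul_gaussian (hm : 1 ≤ m) (N : ℕ) :
    Integrable fun x : E m => ‖x‖ ^ N * Real.exp (-‖x‖ ^ 2) := by
  have : Nontrivial (E m) := Module.nontrivial_of_finrank_pos (R := ℝ)
    (by rw [finrank_euclideanSpace_fin]; omega)
  rw [integrable_fun_norm_addHaar (volume : Measure (E m))
    (f := fun r => r ^ N * Real.exp (-r ^ 2))]
  have h := integrableOn_rpow_mul_exp_neg_mul_sq (b := 1) one_pos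
    (s := ((Module.finrank ℝ (E m) - 1 + N : ℕ) : ℝ))
    (by linarith [(Nat.cast_nonneg _ : (0 : ℝ) ≤ (Module.finrank ℝ (E m) - 1 + N : ℕ))])
  refine h.congr_fun (fun y _ => ?_) measurableSet_Ioi
  simp only [Real.rpow_natCast, smul_eq_mul, pow_add, neg_mul, one_mul, mul_assoc]

theorem IsHomogeneousFun.exists_bound {N : ℕ} {h : E m → Cl m} (hh : IsHomogeneousFun N h)
    (hc : Continuous h) : ∃ C : ℝ, ∀ x, x ≠ 0 → ‖h x‖ ≤ C * ‖x‖ ^ N := by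
  obtain ⟨C, hC⟩ := (isCompact_sphere (0 : E m) 1).exists_bound_of_continuousOn hc.continuousOn
  refine ⟨C, fun x hx => ?_⟩
  have hx0 : 0 < ‖x‖ := norm_pos_iff.2 hx
  have h1 := hC (‖x‖⁻¹ • x) (by simpa using norm_smul_inv_norm (𝕜 := ℝ) hx)
  have h2 := hh ‖x‖ hx0 (‖x‖⁻¹ • x)
  rw [smul_smul, mul_inv_cancel₀ hx0.ne', one_smul] at h2
  rw [h2, norm_smul, Real.norm_eq_abs, abs_of_nonneg (by positivity), mul_comm]
  gcongr

theorem IsHomogeneousFun.integrable_gaussian {N : ℕ} {h : E m → Cl m} (hm : 1 ≤ m)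
    (hh : IsHomogeneousFun N h) (hc : Continuous h) :
    Integrable fun x : E m => Real.exp (-‖x‖ ^ 2) • h x := by
  have : Nontrivial (E m) := Module.nontrivial_of_finrank_pos (R := ℝ)
    (by rw [finrank_euclideanSpace_fin]; omega)
  obtain ⟨C, hC⟩ := hh.exists_bound hc
  have hcont : Continuous fun x : E m => Real.exp (-‖x‖ ^ 2) • h x := by fun_prop
  refine ((integrable_norm_pow_mul_gaussian hm N).const_mul C).mono' hcont.aestronglyMeasurable ?_
  have h0 : ∀ᵐ x : E m, x ≠ 0 := by
    simp [ae_iff]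
  filter_upwards [h0] with x hx
  rw [norm_smul, Real.norm_eq_abs, abs_of_pos (Real.exp_pos _)]
  calc Real.exp (-‖x‖ ^ 2) * ‖h x‖ ≤ Real.exp (-‖x‖ ^ 2) * (C * ‖x‖ ^ N) := by
        gcongr; exact hC x hx
    _ = _ := by ring

/-- Homogeneity separates the radial and spherical variables. Since the radial factor is positive, a
vanishing Gaussian integral forces a vanishing sphere integral. -/
theorem IsHomogeneousFun.integral_gaussian {N : ℕ} {h : E m → Cl m}
    (hh : IsHomogeneousFun N h) (hm : 1 ≤ m) :
    ∫ x : E m, Real.exp (-‖x‖ ^ 2) • h x =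
      (∫ y in Ioi (0 : ℝ), y ^ (m - 1) * (y ^ N * Real.exp (-y ^ 2))) •
        ∫ u : Metric.sphere (0 : E m) 1, h u ∂sphereArea m := by
  have : Nontrivial (E m) := Module.nontrivial_of_finrank_pos (R := ℝ)
    (by rw [finrank_euclideanSpace_fin]; omega)
  set F : Metric.sphere (0 : E m) 1 × Ioi (0 : ℝ) → Cl m := fun z =>
    ((z.2 : ℝ) ^ N * Real.exp (-(z.2 : ℝ) ^ 2)) • h z.1 with hF
  have hpt : ∀ x : ({(0)}ᶜ : Set (E m)),
      Real.exp (-‖(x : E m)‖ ^ 2) • h x = F (homeomorphUnitSphereProd (E m) x) := by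
    intro x
    have hx0 : 0 < ‖(x : E m)‖ := norm_pos_iff.2 x.2
    have h2 := hh ‖(x : E m)‖ hx0 (‖(x : E m)‖⁻¹ • (x : E m))
    rw [smul_smul, mul_inv_cancel₀ hx0.ne', one_smul] at h2
    simp only [hF, homeomorphUnitSphereProd_apply_snd_coe, homeomorphUnitSphereProd_apply_fst_coe]
    rw [h2, smul_smul, mul_comm]
  calc ∫ x : E m, Real.exp (-‖x‖ ^ 2) • h x
      = ∫ x : ({(0)}ᶜ : Set (E m)), Real.exp (-‖(x : E m)‖ ^ 2) • h x
          ∂((volume : Measure (E m)).comap (↑)) := by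
        rw [integral_subtype_comap (measurableSet_singleton _).compl
          fun x : E m => Real.exp (-‖x‖ ^ 2) • h x, restrict_compl_singleton]
    _ = ∫ z, F z ∂(sphereArea m).prod (.volumeIoiPow (m - 1)) := by
        simp only [hpt]
        have := (volume : Measure (E m)).measurePreserving_homeomorphUnitSphereProd.integral_comp
          (Homeomorph.measurableEmbedding _) F
        rw [finrank_euclideanSpace_fin] at this
        exact this
    _ = ∫ z, F z.swap ∂(Measure.volumeIoiPow (m - 1)).prod (sphereArea m) := by
        have : SFinite (sphereArea m) := by unfold sphereArea; infer_instance
        exact (integral_prod_swap F).symm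
    _ = _ := by
        have : SFinite (sphereArea m) := by unfold sphereArea; infer_instance
        rw [← integral_volumeIoiPow (m - 1) fun y => y ^ N * Real.exp (-y ^ 2)]
        exact integral_prod_smul (fun y : Ioi (0 : ℝ) => (y : ℝ) ^ N * Real.exp (-(y : ℝ) ^ 2))
          fun u : Metric.sphere (0 : E m) 1 => h u

end GaussianPolar

/-! ### Fischer orthogonality on the sphere. -/

section SphereOrthogonality

variable {m : ℕ}

/-- The minus sign comes from the conjugate of e_j being -e_j. This identity feeds both the sphere
orthogonality and Stokes' theorem in x. -/
theorem sum_fderiv_star_mul {a b : E m → Cl m} {x : E m} (ha : DifferentiableAt ℝ a x)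
    (hb : DifferentiableAt ℝ b x) :
    ∑ j, fderiv ℝ (fun y => star (a y) * (vec (e j) * b y)) x (e j) =
      star (a x) * dirac b x - star (dirac a x) * b x := by
  have hs : DifferentiableAt ℝ (fun y => star (a y)) x :=
    ((clStar m).differentiableAt).comp x ha
  have hm : ∀ j, DifferentiableAt ℝ (fun y => vec (e j) * b y) x := fun j =>
    ((clMul m (vec (e j))).differentiableAt).comp x hb
  simp only [dirac, star_sum, star_mul, star_vec, Finset.mul_sum, Finset.sum_mul,
    ← Finset.sum_sub_distrib]
  refine Finset.sum_congr rfl fun j _ => ?_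
  rw [fderiv_cl_mul hs (hm j), fderiv_cl_star ha, fderiv_cl_const_mul _ hb]
  simp only [mul_neg, neg_mul, sub_neg_eq_add, mul_assoc]
  rw [add_comm]

theorem sum_smul_star_mul (a b : Cl m) (x : E m) :
    ∑ j, x j • (star a * (vec (e j) * b)) = star a * (vec x * b) := by
  rw [vec_eq_sum x, Finset.sum_mul, Finset.mul_sum]
  simp only [smul_mul_assoc, mul_smul_comm]

theorem IsHomogeneousFun.star_mul {k l : ℕ} {p q : E m → Cl m} (hp : IsHomogeneousFun k p)
    (hq : IsHomogeneousFun l q) (c : Cl m) :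
    IsHomogeneousFun (k + l) fun u => star (p u) * (c * q u) := by
  intro t ht u
  simp only [hp t ht u, hq t ht u, CliffordAlgebra.star_smul, mul_smul_comm, smul_mul_assoc,
    smul_smul, pow_add, mul_comm]

/-- Fischer orthogonality of `ℳ_k` and `u ℳ_l` on the unit sphere. -/
theorem IsMonogenic.integral_sphere_star_mul_vec_mul {k l : ℕ} {p q : E m → Cl m} (hm : 1 ≤ m)
    (hkl : 1 ≤ k + l) (hp : IsMonogenic k p) (hq : IsMonogenic l q) :
    ∫ u : Metric.sphere (0 : E m) 1, star (p u) * (vec (u : E m) * q u) ∂sphereArea m = 0 := by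
  set g : Fin m → E m → Cl m := fun j u => star (p u) * (vec (e j) * q u) with hg
  set φ : E m → ℝ := fun x => Real.exp (-‖x‖ ^ 2) with hφ
  have hgs : ∀ j, ContDiff ℝ ∞ (g j) := fun j =>
    contDiff_cl_mul (contDiff_cl_star hp.smooth) (contDiff_cl_mul contDiff_const hq.smooth)
  have hgd : ∀ j, Differentiable ℝ (g j) := fun j => (hgs j).differentiable (by simp)
  have hgh : ∀ j, IsHomogeneousFun (k + l) (g j) := fun j => hp.homog.star_mul hq.homog _
  have hxg : ∀ j, IsHomogeneousFun (k + l + 1) fun x => (-(2 * x j)) • g j x := by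
    intro j t ht u
    simp only [hgh j t ht u, PiLp.smul_apply, smul_eq_mul, smul_smul]
    congr 1; ring
  have hφd : ∀ x v, fderiv ℝ φ x v = φ x * (-(2 * ⟪x, v⟫_ℝ)) := by
    intro x v
    have h1 : HasFDerivAt φ (Real.exp (-‖x‖ ^ 2) • (-((2 : ℕ) • innerSL ℝ x) : E m →L[ℝ] ℝ)) x :=
      ((hasStrictFDerivAt_norm_sq x).hasFDerivAt.neg).exp
    rw [h1.fderiv]
    simp [hφ]
  have hφdiff : Differentiable ℝ φ := by
    have : ContDiff ℝ 1 φ := ((contDiff_norm_sq ℝ).neg).exp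
    exact this.differentiable (by norm_num)
  have hxj : ∀ (j : Fin m) (x : E m), ⟪x, e j⟫_ℝ = x j := fun j x => by
    simp [EuclideanSpace.inner_single_right]
  have i1 : ∀ j, Integrable fun x => φ x • fderiv ℝ (g j) x (e j) := fun j =>
    ((hgh j).fderiv_apply hkl (hgd j) (e j)).integrable_gaussian hm
      (contDiff_fderiv_apply (hgs j) (e j)).continuous
  have i2 : ∀ j, Integrable fun x => fderiv ℝ φ x (e j) • g j x := fun j => by
    have := (hxg j).integrable_gaussian hm (by
      have := (hgs j).continuous
      fun_prop)
    refine this.congr (Eventually.of_forall fun x => ?_)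
    simp only [hφd, hxj, mul_smul]
    rfl
  have i3 : ∀ j, Integrable fun x => φ x • g j x := fun j =>
    (hgh j).integrable_gaussian hm (hgs j).continuous
  have ibp : ∀ j, ∫ x, φ x • fderiv ℝ (g j) x (e j) = -∫ x, fderiv ℝ φ x (e j) • g j x := fun j =>
    integral_smul_fderiv_eq_neg_fderiv_smul_of_integrable (i2 j) (i1 j) (i3 j)
      (fun x _ => hφdiff x) (fun x _ => hgd j x)
  -- The divergence of (p̄ e_j q)_j is p̄ Dq - (Dp)‾ q, which vanishes.
  have hsum0 : ∑ j, ∫ x, φ x • fderiv ℝ (g j) x (e j) = 0 := by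
    rw [← integral_finsetSum _ fun j _ => i1 j]
    have : ∀ x, ∑ j, φ x • fderiv ℝ (g j) x (e j) = 0 := fun x => by
      rw [← Finset.smul_sum, sum_fderiv_star_mul (hp.smooth.differentiable (by simp) x)
        (hq.smooth.differentiable (by simp) x), hp.dirac_eq_zero, hq.dirac_eq_zero]
      simp
    simp [this]
  -- ∂_jφ = -2x_jφ reassembles the vector x between p̄ and q.
  have hsum1 : ∑ j, ∫ x, fderiv ℝ φ x (e j) • g j x =
      (-2 : ℝ) • ∫ x, φ x • (star (p x) * (vec x * q x)) := by
    rw [← integral_finsetSum _ fun j _ => i2 j, ← integral_smul]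
    refine integral_congr_ae (Eventually.of_forall fun x => ?_)
    beta_reduce
    rw [← sum_smul_star_mul (p x) (q x) x]
    simp only [hφd, hxj, Finset.smul_sum, smul_smul, hg]
    exact Finset.sum_congr rfl fun j _ => by congr 1; ring
  have hzero : ∫ x, φ x • (star (p x) * (vec x * q x)) = 0 := by
    simp only [ibp, Finset.sum_neg_distrib, hsum1] at hsum0
    simpa using hsum0
  have hh : IsHomogeneousFun (k + l + 1) fun x => star (p x) * (vec x * q x) := by
    intro t ht u
    have h2 : vec (t • u) = t • vec u := map_smul (CliffordAlgebra.ι (cliffordForm m)) t u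
    simp only [hp.homog t ht u, hq.homog t ht u, h2, CliffordAlgebra.star_smul, mul_smul_comm,
      smul_mul_assoc, smul_smul]
    congr 1; ring
  rw [hh.integral_gaussian hm] at hzero
  refine (smul_eq_zero.1 hzero).resolve_left (ne_of_gt ?_)
  have h := integral_pow_mul_gaussian_pos (m - 1 + (k + l + 1))
  simpa only [pow_add, mul_assoc] using h

end SphereOrthogonality

/-! ### Stokes' theorem for the Dirac operator, and integrability for Fubini. -/

section CliffordStokes

variable {m : ℕ} {Ω : Set (E m)}

/-- Linear functionals separate points of Cl_m, which reduces the formula to the scalar one. -/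
theorem setIntegral_fderiv_cl_eq_integral_boundaryArea (hΩ : IsOpen Ω)
    (hbd : Bornology.IsBounded Ω) (hb : HasC1Boundary Ω) {G : E m → Cl m} (hG : ContDiff ℝ ∞ G)
    (v : E m) :
    ∫ x in Ω, fderiv ℝ G x v = ∫ x, ⟪outwardNormal Ω x, v⟫_ℝ • G x ∂boundaryArea Ω := by
  have : CompleteSpace (Cl m) := FiniteDimensional.complete ℝ _
  have hcn : ContinuousOn (fun x => ⟪outwardNormal Ω x, v⟫_ℝ) (frontier Ω) :=
    (continuousOn_outwardNormal hΩ hb).inner continuousOn_const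
  have i1 : Integrable (fun x => ⟪outwardNormal Ω x, v⟫_ℝ • G x) (boundaryArea Ω) :=
    integrable_boundaryArea_of_continuousOn hΩ hbd hb (hcn.smul hG.continuous.continuousOn)
  have i2 : IntegrableOn (fun x => fderiv ℝ G x v) Ω :=
    ((contDiff_fderiv_apply hG v).continuous.continuousOn.integrableOn_compact
      hbd.isCompact_closure).mono_set subset_closure
  refine (SeparatingDual.eq_iff_forall_dual_eq (R := ℝ)).2 fun L => ?_
  rw [← L.integral_comp_comm i1, ← L.integral_comp_comm i2]
  have h := setIntegral_fderiv_eq_integral_boundaryArea hΩ hbd hb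
    (G := fun x => L (G x)) ((L.contDiff.comp hG).of_le ENat.LEInfty.out) v
  have h2 : ∀ x, fderiv ℝ (fun x => L (G x)) x v = L (fderiv ℝ G x v) := fun x => by
    have := (L.hasFDerivAt.comp x ((hG.differentiable (by simp)) x).hasFDerivAt).fderiv
    have h3 : (fun x => L (G x)) = ⇑L ∘ G := rfl
    rw [h3, this]; rfl
  simp only [h2] at h
  rw [h]
  simp only [map_smul, smul_eq_mul, mul_comm]

/-- Stokes' theorem for the Dirac operator. -/
theorem integral_boundaryArea_star_mul_vec_outwardNormal_mul (hΩ : IsOpen Ω)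
    (hbd : Bornology.IsBounded Ω) (hb : HasC1Boundary Ω) {a b : E m → Cl m}
    (ha : ContDiff ℝ ∞ a) (hbs : ContDiff ℝ ∞ b) :
    ∫ x, star (a x) * (vec (outwardNormal Ω x) * b x) ∂boundaryArea Ω =
      ∫ x in Ω, (star (a x) * dirac b x - star (dirac a x) * b x) := by
  set g : Fin m → E m → Cl m := fun j x => star (a x) * (vec (e j) * b x) with hg
  have hgs : ∀ j, ContDiff ℝ ∞ (g j) := fun j =>
    contDiff_cl_mul (contDiff_cl_star ha) (contDiff_cl_mul contDiff_const hbs)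
  have hcn : ∀ v, ContinuousOn (fun x => ⟪outwardNormal Ω x, v⟫_ℝ) (frontier Ω) := fun v =>
    (continuousOn_outwardNormal hΩ hb).inner continuousOn_const
  have i1 : ∀ j, Integrable (fun x => ⟪outwardNormal Ω x, e j⟫_ℝ • g j x) (boundaryArea Ω) :=
    fun j => integrable_boundaryArea_of_continuousOn hΩ hbd hb
      ((hcn _).smul (hgs j).continuous.continuousOn)
  have i2 : ∀ j, IntegrableOn (fun x => fderiv ℝ (g j) x (e j)) Ω := fun j =>
    ((contDiff_fderiv_apply (hgs j) _).continuous.continuousOn.integrableOn_compact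
      hbd.isCompact_closure).mono_set subset_closure
  have hj : ∀ (j : Fin m) (x : E m), ⟪x, e j⟫_ℝ = x j := fun j x => by
    simp [EuclideanSpace.inner_single_right]
  calc ∫ x, star (a x) * (vec (outwardNormal Ω x) * b x) ∂boundaryArea Ω
      = ∑ j, ∫ x, ⟪outwardNormal Ω x, e j⟫_ℝ • g j x ∂boundaryArea Ω := by
        rw [← integral_finsetSum _ fun j _ => i1 j]
        refine integral_congr_ae (Eventually.of_forall fun x => ?_)
        beta_reduce
        rw [← sum_smul_star_mul]
        simp only [hj, hg]
    _ = ∑ j, ∫ x in Ω, fderiv ℝ (g j) x (e j) := Finset.sum_congr rfl fun j _ =>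
        (setIntegral_fderiv_cl_eq_integral_boundaryArea hΩ hbd hb (hgs j) (e j)).symm
    _ = _ := by
        rw [← integral_finsetSum _ fun j _ => i2 j]
        refine integral_congr_ae (Eventually.of_forall fun x => ?_)
        exact sum_fderiv_star_mul (ha.differentiable (by simp) x) (hbs.differentiable (by simp) x)

instance isFiniteMeasure_sphereArea (m : ℕ) : IsFiniteMeasure (sphereArea m) := by
  unfold sphereArea; infer_instance

theorem integrable_sphereArea_of_continuous {h : E m → Cl m} (hc : Continuous h) :
    Integrable (fun u : Metric.sphere (0 : E m) 1 => h u) (sphereArea m) :=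
  (hc.comp continuous_subtype_val).integrable_of_hasCompactSupport
    (HasCompactSupport.of_compactSpace _)

/-- Continuity is asked only over K, since the normal field is continuous just along the frontier.
-/
theorem integrable_prod_sphereArea_of_continuousOn {μ : Measure (E m)} {K : Set (E m)}
    (hK : IsCompact K) (hμ : IsFiniteMeasure μ) (hμK : μ Kᶜ = 0) {F : Field m}
    (hF : ContinuousOn (fun z : E m × E m => F z.1 z.2) (K ×ˢ univ)) :
    Integrable (Function.uncurry fun (x : E m) (u : Metric.sphere (0 : E m) 1) => F x u)
      (μ.prod (sphereArea m)) := by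
  have hKc : IsCompact (K ×ˢ (univ : Set (Metric.sphere (0 : E m) 1))) := hK.prod isCompact_univ
  have hcont : ContinuousOn
      (Function.uncurry fun (x : E m) (u : Metric.sphere (0 : E m) 1) => F x u)
      (K ×ˢ (univ : Set (Metric.sphere (0 : E m) 1))) :=
    hF.comp (g := fun z : E m × E m => F z.1 z.2)
      (f := fun z : E m × Metric.sphere (0 : E m) 1 => (z.1, (z.2 : E m)))
      (by fun_prop) (fun z hz => ⟨hz.1, mem_univ _⟩)
  have hμ' : μ.restrict K = μ := Measure.restrict_eq_self_of_ae_mem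
    (by rw [ae_iff]; exact hμK)
  obtain ⟨C, hC⟩ := hKc.exists_bound_of_continuousOn hcont
  have hmeas : (μ.prod (sphereArea m)).restrict (K ×ˢ univ) = μ.prod (sphereArea m) := by
    rw [← Measure.prod_restrict, hμ', Measure.restrict_univ]
  rw [← hmeas]
  refine Integrable.of_bound (C := C)
    (hcont.aestronglyMeasurable_of_isCompact hKc hKc.measurableSet) ?_
  exact (ae_restrict_iff' hKc.measurableSet).2 (Eventually.of_forall hC)

end CliffordStokes

/-! ### The operator matrix on Almansi components, and adjointness of the projections. -/

section Components

variable {m k : ℕ}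

theorem IsSmoothHarm.isHarmonicHomog {f : Field m} (hf : IsSmoothHarm k f) (x : E m) :
    IsHarmonicHomog k (f x) where
  smooth := IsSmoothField.right hf.1 x
  homog := isHomogeneousFun_of_mem_homPoly (hf.2 x).1
  lap_eq_zero u := by rw [lap_eq_laplacian (IsSmoothField.right hf.1 x), (hf.2 x).2 u]

theorem Pplus_apply (f : Field m) (x : E m) : Pplus k f x = projPlus k (f x) := rfl

theorem Pminus_apply (f : Field m) (x : E m) :
    Pminus k f x = fun u => f x u - projPlus k (f x) u := rfl

theorem isSmoothField_Pplus {f : Field m} (hf : IsSmoothField f) :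
    IsSmoothField (Pplus k f) := hf.projPlus k

theorem isSmoothField_Pminus {f : Field m} (hf : IsSmoothField f) :
    IsSmoothField (Pminus k f) := hf.sub (hf.projPlus k)

theorem IsSmoothHarm.isMonogenic_Pplus {f : Field m} (hm : 1 ≤ m) (hk : 1 ≤ k)
    (hf : IsSmoothHarm k f) (x : E m) : IsMonogenic k (Pplus k f x) :=
  (hf.isHarmonicHomog x).isMonogenic_projPlus hm hk

theorem IsSmoothHarm.isHarmonicHomog_Pminus {f : Field m} (hm : 1 ≤ m) (hk : 1 ≤ k)
    (hf : IsSmoothHarm k f) (x : E m) : IsHarmonicHomog k (Pminus k f x) :=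
  (hf.isHarmonicHomog x).sub (hf.isMonogenic_Pplus hm hk x).isHarmonicHomog

/-- On almansi components the matrix `𝑫₁` acts diagonally. -/
theorem at2_D1_almansi {f : Field m} (hm : 1 ≤ m) (hk : 1 ≤ k) (hf : IsSmoothHarm k f)
    (x u : E m) :
    at2 (D1 k (almansi k f)) x u =
      ![-projPlus k (diracX (Pplus k f) x) u,
        √(((m : ℝ) + 2 * k) / ((m : ℝ) + 2 * k - 4)) •
          (diracX (Pminus k f) x u - projPlus k (diracX (Pminus k f) x) u)] := by
  -- The four compositions of P⁺ and P⁻: idempotence keeps the diagonal entries, and the zero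
  -- products remove the twistor entries.
  have hpp : Pplus k (Pplus k f) = Pplus k f := funext fun x =>
    projPlus_eq_self (hf.isMonogenic_Pplus hm hk x).dirac_eq_zero
  have hpm : Pplus k (Pminus k f) = fun _ _ => 0 := funext fun x =>
    (hf.isHarmonicHomog x).projPlus_sub_projPlus hm hk
  have hmp : Pminus k (Pplus k f) = fun _ _ => 0 := by
    funext x u
    rw [Pminus, hpp, sub_self]
  have hmm : Pminus k (Pminus k f) = Pminus k f := by
    funext x u
    rw [Pminus, hpm, sub_zero]
  have h0 : diracX (fun _ _ => 0 : Field m) = fun _ _ => 0 := by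
    funext x u; simp [diracX, dirac]
  have h1 : Pplus k (fun _ _ => 0 : Field m) = fun _ _ => 0 := by
    funext x u; simp [Pplus, dirac]
  have h2 : Pminus k (fun _ _ => 0 : Field m) = fun _ _ => 0 := by
    funext x u; simp [Pminus, h1]
  funext i
  fin_cases i
  · simp [at2, D1, matD1, almansi, Fin.sum_univ_two, hpp, hpm, opR, opTdual, h0, h2, Pplus_apply]
  · simp [at2, D1, matD1, almansi, Fin.sum_univ_two, hmp, hmm, opT, opQ, h0, h1, Pminus_apply]

/-- Sphere orthogonality of `ℳ_k` and the `P_k^-`-component of `ℋ_k`. -/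
theorem IsMonogenic.integral_sphere_star_mul_sub_projPlus {p h : E m → Cl m} (hm : 1 ≤ m)
    (hk : 1 ≤ k) (hp : IsMonogenic k p) (hh : IsHarmonicHomog k h) :
    (∫ u : Metric.sphere (0 : E m) 1, star (p u) * (h u - projPlus k h u) ∂sphereArea m = 0) ∧
    ∫ u : Metric.sphere (0 : E m) 1, star (h u - projPlus k h u) * p u ∂sphereArea m = 0 := by
  have hq := hh.isMonogenic_dirac hk
  have h1 := hp.integral_sphere_star_mul_vec_mul hm (by omega) hq
  have h2 := hq.integral_sphere_star_mul_vec_mul hm (by omega) hp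
  constructor
  · simp only [sub_projPlus_apply, mul_neg, mul_smul_comm]
    rw [integral_neg, integral_smul, h1, smul_zero, neg_zero]
  · simp only [sub_projPlus_apply, star_neg, CliffordAlgebra.star_smul, star_mul, star_vec,
      mul_neg, smul_neg, neg_neg, smul_mul_assoc, mul_assoc]
    rw [integral_smul, h2, smul_zero]

/-- Against a monogenic p the discarded part h - P⁺h integrates to zero, on either side of the
product. -/
theorem integral_sphere_star_projPlus_mul {p h : E m → Cl m} (hm : 1 ≤ m) (hk : 1 ≤ k)
    (hp : IsMonogenic k p) (hh : IsHarmonicHomog k h) :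
    (∫ u : Metric.sphere (0 : E m) 1, star (p u) * projPlus k h u ∂sphereArea m =
      ∫ u : Metric.sphere (0 : E m) 1, star (p u) * h u ∂sphereArea m) ∧
    ∫ u : Metric.sphere (0 : E m) 1, star (projPlus k h u) * p u ∂sphereArea m =
      ∫ u : Metric.sphere (0 : E m) 1, star (h u) * p u ∂sphereArea m := by
  obtain ⟨h1, h2⟩ := hp.integral_sphere_star_mul_sub_projPlus hm hk hh
  have cp := hp.smooth.continuous
  have ch := hh.smooth.continuous
  have cq := (contDiff_projPlus (k := k) hh.smooth).continuous
  constructor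
  · simp only [mul_sub] at h1
    rw [integral_sub
      (integrable_sphereArea_of_continuous (continuous_cl_mul (continuous_cl_star cp) ch))
      (integrable_sphereArea_of_continuous (continuous_cl_mul (continuous_cl_star cp) cq))] at h1
    exact (sub_eq_zero.1 h1).symm
  · simp only [star_sub, sub_mul] at h2
    rw [integral_sub
      (integrable_sphereArea_of_continuous (continuous_cl_mul (continuous_cl_star ch) cp))
      (integrable_sphereArea_of_continuous (continuous_cl_mul (continuous_cl_star cq) cp))] at h2
    exact (sub_eq_zero.1 h2).symm

/-- The counterpart for P⁻: the discarded part P⁺h is monogenic, hence orthogonal to P⁻p. -/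
theorem integral_sphere_star_sub_projPlus_mul_sub_projPlus {p h : E m → Cl m} (hm : 1 ≤ m)
    (hk : 1 ≤ k) (hp : IsHarmonicHomog k p) (hh : IsHarmonicHomog k h) :
    (∫ u : Metric.sphere (0 : E m) 1,
        star (p u - projPlus k p u) * (h u - projPlus k h u) ∂sphereArea m =
      ∫ u : Metric.sphere (0 : E m) 1, star (p u - projPlus k p u) * h u ∂sphereArea m) ∧
    ∫ u : Metric.sphere (0 : E m) 1,
        star (h u - projPlus k h u) * (p u - projPlus k p u) ∂sphereArea m =
      ∫ u : Metric.sphere (0 : E m) 1, star (h u) * (p u - projPlus k p u) ∂sphereArea m := by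
  have hM := hh.isMonogenic_projPlus hm hk
  obtain ⟨h1, h2⟩ := hM.integral_sphere_star_mul_sub_projPlus hm hk hp
  have cp : Continuous fun u => p u - projPlus k p u :=
    hp.smooth.continuous.sub (contDiff_projPlus hp.smooth).continuous
  have ch := hh.smooth.continuous
  have cq := (contDiff_projPlus (k := k) hh.smooth).continuous
  constructor
  · simp only [mul_sub]
    rw [integral_sub
      (integrable_sphereArea_of_continuous (continuous_cl_mul (continuous_cl_star cp) ch))
      (integrable_sphereArea_of_continuous (continuous_cl_mul (continuous_cl_star cp) cq)),
      h2, sub_zero]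
  · simp only [star_sub (h _), sub_mul]
    rw [integral_sub
      (integrable_sphereArea_of_continuous (continuous_cl_mul (continuous_cl_star ch) cp))
      (integrable_sphereArea_of_continuous (continuous_cl_mul (continuous_cl_star cq) cp)),
      h1, sub_zero]

end Components

/-! ### Removal of the projections and assembly of the theorem. -/

section Main

variable {m k : ℕ} {Ω : Set (E m)} {f g : Field m}

theorem continuous_star_mul {a b : Field m} (ha : IsSmoothField a) (hb : IsSmoothField b) :
    Continuous fun z : E m × E m => star (a z.1 z.2) * b z.1 z.2 :=
  continuous_cl_mul (continuous_cl_star ha.continuous) hb.continuous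

theorem integral_sphere_add_smul {A B : E m → Cl m} (s : ℝ) (hA : Continuous A)
    (hB : Continuous B) :
    ∫ u : Metric.sphere (0 : E m) 1, (A u + s • B u) ∂sphereArea m =
      (∫ u : Metric.sphere (0 : E m) 1, A u ∂sphereArea m) +
        s • ∫ u : Metric.sphere (0 : E m) 1, B u ∂sphereArea m := by
  rw [integral_add (integrable_sphereArea_of_continuous hA)
    ((integrable_sphereArea_of_continuous hB).fun_smul s), integral_smul]

/-- D_x f^± stays harmonic and homogeneous in u, so after integration over u the projections in 𝑫₁
can be dropped against g^±, leaving the bare operator D_x. -/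
theorem integral_sphere_star_D1_dotProduct (hm : 1 ≤ m) (hk : 1 ≤ k) (hf : IsSmoothHarm k f)
    (hg : IsSmoothHarm k g) (x : E m) :
    ∫ u : Metric.sphere (0 : E m) 1,
        star (at2 (D1 k (almansi k f)) x u) ⬝ᵥ at2 (almansi k g) x u ∂sphereArea m =
      ∫ u : Metric.sphere (0 : E m) 1,
        (-(star (diracX (Pplus k f) x u) * Pplus k g x u) +
          √(((m : ℝ) + 2 * k) / ((m : ℝ) + 2 * k - 4)) •
            (star (diracX (Pminus k f) x u) * Pminus k g x u)) ∂sphereArea m := by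
  set s := √(((m : ℝ) + 2 * k) / ((m : ℝ) + 2 * k - 4)) with hs
  have h1 := isHarmonicHomog_diracX (isSmoothField_Pplus (k := k) hf.1)
    (fun x => (hf.isMonogenic_Pplus hm hk x).isHarmonicHomog) x
  have h2 := isHarmonicHomog_diracX (isSmoothField_Pminus (k := k) hf.1)
    (hf.isHarmonicHomog_Pminus hm hk) x
  have hM := hg.isMonogenic_Pplus hm hk x
  have e1 := (integral_sphere_star_projPlus_mul hm hk hM h1).2
  have e2 := (integral_sphere_star_sub_projPlus_mul_sub_projPlus hm hk
    (hg.isHarmonicHomog x) h2).2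
  have c1 := h1.smooth.continuous
  have c2 := h2.smooth.continuous
  have c3 := hM.smooth.continuous
  have c4 : Continuous (Pminus k g x) := (hg.isHarmonicHomog_Pminus hm hk x).smooth.continuous
  have c5 := (contDiff_projPlus (k := k) h1.smooth).continuous
  have c6 := (contDiff_projPlus (k := k) h2.smooth).continuous
  rw [integral_sphere_add_smul (A := fun u => -(star (diracX (Pplus k f) x u) * Pplus k g x u))
    (B := fun u => star (diracX (Pminus k f) x u) * Pminus k g x u) s
    (continuous_cl_mul (continuous_cl_star c1) c3).neg
    (continuous_cl_mul (continuous_cl_star c2) c4), integral_neg, ← e1]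
  have e2' : ∫ u : Metric.sphere (0 : E m) 1,
      star (diracX (Pminus k f) x u - projPlus k (diracX (Pminus k f) x) u) *
        Pminus k g x u ∂sphereArea m =
      ∫ u : Metric.sphere (0 : E m) 1, star (diracX (Pminus k f) x u) *
        Pminus k g x u ∂sphereArea m := e2
  rw [← e2', ← integral_neg, ← integral_sphere_add_smul
    (A := fun u => -(star (projPlus k (diracX (Pplus k f) x) u) * Pplus k g x u))
    (B := fun u => star (diracX (Pminus k f) x u - projPlus k (diracX (Pminus k f) x) u) *
        Pminus k g x u) s
    (continuous_cl_mul (continuous_cl_star c5) c3).neg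
    (continuous_cl_mul (continuous_cl_star (c2.sub c6)) c4)]
  refine integral_congr_ae (Eventually.of_forall fun u => ?_)
  simp only [at2_D1_almansi hm hk hf, ← hs]
  simp [dotProduct, Fin.sum_univ_two, at2, almansi, CliffordAlgebra.star_smul]

theorem integral_sphere_star_dotProduct_D1 (hm : 1 ≤ m) (hk : 1 ≤ k) (hf : IsSmoothHarm k f)
    (hg : IsSmoothHarm k g) (x : E m) :
    ∫ u : Metric.sphere (0 : E m) 1,
        star (at2 (almansi k f) x u) ⬝ᵥ at2 (D1 k (almansi k g)) x u ∂sphereArea m =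
      ∫ u : Metric.sphere (0 : E m) 1,
        (-(star (Pplus k f x u) * diracX (Pplus k g) x u) +
          √(((m : ℝ) + 2 * k) / ((m : ℝ) + 2 * k - 4)) •
            (star (Pminus k f x u) * diracX (Pminus k g) x u)) ∂sphereArea m := by
  set s := √(((m : ℝ) + 2 * k) / ((m : ℝ) + 2 * k - 4)) with hs
  have h1 := isHarmonicHomog_diracX (isSmoothField_Pplus (k := k) hg.1)
    (fun x => (hg.isMonogenic_Pplus hm hk x).isHarmonicHomog) x
  have h2 := isHarmonicHomog_diracX (isSmoothField_Pminus (k := k) hg.1)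
    (hg.isHarmonicHomog_Pminus hm hk) x
  have hM := hf.isMonogenic_Pplus hm hk x
  have e1 := (integral_sphere_star_projPlus_mul hm hk hM h1).1
  have e2 := (integral_sphere_star_sub_projPlus_mul_sub_projPlus hm hk
    (hf.isHarmonicHomog x) h2).1
  have c1 := h1.smooth.continuous
  have c2 := h2.smooth.continuous
  have c3 := hM.smooth.continuous
  have c4 : Continuous (Pminus k f x) := (hf.isHarmonicHomog_Pminus hm hk x).smooth.continuous
  have c5 := (contDiff_projPlus (k := k) h1.smooth).continuous
  have c6 := (contDiff_projPlus (k := k) h2.smooth).continuous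
  rw [integral_sphere_add_smul (A := fun u => -(star (Pplus k f x u) * diracX (Pplus k g) x u))
    (B := fun u => star (Pminus k f x u) * diracX (Pminus k g) x u) s
    (continuous_cl_mul (continuous_cl_star c3) c1).neg
    (continuous_cl_mul (continuous_cl_star c4) c2), integral_neg, ← e1]
  have e2' : ∫ u : Metric.sphere (0 : E m) 1, star (Pminus k f x u) *
      (diracX (Pminus k g) x u - projPlus k (diracX (Pminus k g) x) u) ∂sphereArea m =
      ∫ u : Metric.sphere (0 : E m) 1, star (Pminus k f x u) *
        diracX (Pminus k g) x u ∂sphereArea m := e2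
  rw [← e2', ← integral_neg, ← integral_sphere_add_smul
    (A := fun u => -(star (Pplus k f x u) * projPlus k (diracX (Pplus k g) x) u))
    (B := fun u => star (Pminus k f x u) *
      (diracX (Pminus k g) x u - projPlus k (diracX (Pminus k g) x) u)) s
    (continuous_cl_mul (continuous_cl_star c3) c5).neg
    (continuous_cl_mul (continuous_cl_star c4) (c2.sub c6))]
  refine integral_congr_ae (Eventually.of_forall fun u => ?_)
  simp only [at2_D1_almansi hm hk hg, ← hs]
  simp [dotProduct, Fin.sum_univ_two, at2, almansi]

theorem star_dotProduct_sigmaMatrix_mulVec (x u : E m) :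
    star (at2 (almansi k f) x u) ⬝ᵥ (sigmaMatrix k Ω x *ᵥ at2 (almansi k g) x u) =
      star (Pplus k f x u) * (vec (outwardNormal Ω x) * Pplus k g x u) -
        √(((m : ℝ) + 2 * k) / ((m : ℝ) + 2 * k - 4)) •
          (star (Pminus k f x u) * (vec (outwardNormal Ω x) * Pminus k g x u)) := by
  simp [dotProduct, Fin.sum_univ_two, at2, almansi, sigmaMatrix, Matrix.mulVec, sub_eq_add_neg]

/-- Stokes' theorem at a fixed value of `u`. -/
theorem integral_boundaryArea_sigma_eq (hΩ : IsOpen Ω) (hbd : Bornology.IsBounded Ω)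
    (hb : HasC1Boundary Ω) {a b a' b' : E m → Cl m} (ha : ContDiff ℝ ∞ a) (hbs : ContDiff ℝ ∞ b)
    (ha' : ContDiff ℝ ∞ a') (hbs' : ContDiff ℝ ∞ b') (s : ℝ) :
    ∫ x, (star (a x) * (vec (outwardNormal Ω x) * b x) -
        s • (star (a' x) * (vec (outwardNormal Ω x) * b' x))) ∂boundaryArea Ω =
      ∫ x in Ω, ((-(star (dirac a x) * b x) + s • (star (dirac a' x) * b' x)) -
        (-(star (a x) * dirac b x) + s • (star (a' x) * dirac b' x))) := by
  have hcn : ContinuousOn (fun x => vec (outwardNormal Ω x)) (frontier Ω) :=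
    (vecL m).continuous.comp_continuousOn (continuousOn_outwardNormal hΩ hb)
  have cmul : ∀ {F G : E m → Cl m} {S : Set (E m)}, ContinuousOn F S → ContinuousOn G S →
      ContinuousOn (fun x => F x * G x) S := fun hF hG =>
    ((clMul m).continuous.comp_continuousOn hF).clm_apply hG
  have i1 : ∀ {a b : E m → Cl m}, ContDiff ℝ ∞ a → ContDiff ℝ ∞ b →
      Integrable (fun x => star (a x) * (vec (outwardNormal Ω x) * b x)) (boundaryArea Ω) :=
    fun ha hb' => integrable_boundaryArea_of_continuousOn hΩ hbd hb
      (cmul (continuous_cl_star ha.continuous).continuousOn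
        (cmul hcn hb'.continuous.continuousOn))
  have i2 : ∀ {a b : E m → Cl m}, ContDiff ℝ ∞ a → ContDiff ℝ ∞ b →
      IntegrableOn (fun x => star (a x) * dirac b x - star (dirac a x) * b x) Ω :=
    fun ha hb' => (((continuous_cl_mul (continuous_cl_star ha.continuous)
      (contDiff_dirac hb').continuous).sub (continuous_cl_mul (continuous_cl_star
        (contDiff_dirac ha).continuous) hb'.continuous)).continuousOn.integrableOn_compact
          hbd.isCompact_closure).mono_set subset_closure
  rw [integral_sub (i1 ha hbs) ((i1 ha' hbs').fun_smul s), integral_smul,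
    integral_boundaryArea_star_mul_vec_outwardNormal_mul hΩ hbd hb ha hbs,
    integral_boundaryArea_star_mul_vec_outwardNormal_mul hΩ hbd hb ha' hbs', ← integral_smul,
    ← integral_sub (i2 ha hbs) (Integrable.fun_smul s (i2 ha' hbs'))]
  refine integral_congr_ae (Eventually.of_forall fun x => ?_)
  beta_reduce
  rw [smul_sub]
  abel

end Main

/-- Stokes' theorem for `𝑫₁`. -/
theorem stokes_D1 (m k : ℕ) (hm : 1 ≤ m) (hk : 1 ≤ k) (Ω : Set (E m))
    (hΩ_open : IsOpen Ω) (hΩ_bdd : Bornology.IsBounded Ω) (hΩ_bdry : HasC1Boundary Ω)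
    (f g : Field m)
    (hf : IsSmoothHarm k f) (hg : IsSmoothHarm k g) :
    (∫ x, (∫ u : Metric.sphere (0 : E m) 1,
        star (at2 (almansi k f) x u) ⬝ᵥ
          (sigmaMatrix k Ω x *ᵥ at2 (almansi k g) x u)
        ∂sphereArea m) ∂boundaryArea Ω) =
      (∫ x in Ω, ∫ u : Metric.sphere (0 : E m) 1,
        star (at2 (D1 k (almansi k f)) x u) ⬝ᵥ
          at2 (almansi k g) x u ∂sphereArea m) -
      ∫ x in Ω, ∫ u : Metric.sphere (0 : E m) 1,
        star (at2 (almansi k f) x u) ⬝ᵥ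
          at2 (D1 k (almansi k g)) x u
        ∂sphereArea m := by
  set s := √(((m : ℝ) + 2 * k) / ((m : ℝ) + 2 * k - 4)) with hs
  have sF1 : IsSmoothField (Pplus k f) := isSmoothField_Pplus hf.1
  have sF2 : IsSmoothField (Pminus k f) := isSmoothField_Pminus hf.1
  have sG1 : IsSmoothField (Pplus k g) := isSmoothField_Pplus hg.1
  have sG2 : IsSmoothField (Pminus k g) := isSmoothField_Pminus hg.1
  have hcl : IsCompact (closure Ω) := hΩ_bdd.isCompact_closure
  have hfr : IsCompact (frontier Ω) :=
    hcl.of_isClosed_subset isClosed_frontier frontier_subset_closure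
  have fin1 : IsFiniteMeasure (boundaryArea Ω) := ⟨boundaryArea_univ_lt_top hΩ_open hΩ_bdd hΩ_bdry⟩
  have fin2 : IsFiniteMeasure (volume.restrict Ω) :=
    ⟨by rw [Measure.restrict_apply_univ]; exact hΩ_bdd.measure_lt_top⟩
  have null1 : boundaryArea Ω (frontier Ω)ᶜ = 0 := by
    rw [boundaryArea, Measure.restrict_apply isClosed_frontier.measurableSet.compl,
      Set.compl_inter_self, measure_empty]
  have null2 : volume.restrict Ω (closure Ω)ᶜ = 0 := by
    rw [Measure.restrict_apply isClosed_closure.measurableSet.compl,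
      (Set.disjoint_compl_left_iff_subset.2 subset_closure).inter_eq, measure_empty]
  set J : Field m := fun x u =>
    star (Pplus k f x u) * (vec (outwardNormal Ω x) * Pplus k g x u) -
      s • (star (Pminus k f x u) * (vec (outwardNormal Ω x) * Pminus k g x u)) with hJ
  set I₁ : Field m := fun x u => -(star (diracX (Pplus k f) x u) * Pplus k g x u) +
    s • (star (diracX (Pminus k f) x u) * Pminus k g x u) with hI₁
  set I₂ : Field m := fun x u => -(star (Pplus k f x u) * diracX (Pplus k g) x u) +
    s • (star (Pminus k f x u) * diracX (Pminus k g) x u) with hI₂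
  have cI₁ : Continuous fun z : E m × E m => I₁ z.1 z.2 :=
    (continuous_star_mul sF1.diracX sG1).neg.add ((continuous_star_mul sF2.diracX sG2).const_smul s)
  have cI₂ : Continuous fun z : E m × E m => I₂ z.1 z.2 :=
    (continuous_star_mul sF1 sG1.diracX).neg.add ((continuous_star_mul sF2 sG2.diracX).const_smul s)
  have hcn : ContinuousOn (fun z : E m × E m => vec (outwardNormal Ω z.1))
      (frontier Ω ×ˢ Set.univ) :=
    (vecL m).continuous.comp_continuousOn ((continuousOn_outwardNormal hΩ_open hΩ_bdry).comp
      continuous_fst.continuousOn fun z hz => hz.1)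
  have cmul : ∀ {F G : E m × E m → Cl m} {S : Set (E m × E m)}, ContinuousOn F S →
      ContinuousOn G S → ContinuousOn (fun x => F x * G x) S := fun hF hG =>
    ((clMul m).continuous.comp_continuousOn hF).clm_apply hG
  have cJ : ContinuousOn (fun z : E m × E m => J z.1 z.2) (frontier Ω ×ˢ Set.univ) :=
    (cmul (continuous_cl_star sF1.continuous).continuousOn
      (cmul hcn sG1.continuous.continuousOn)).sub
    ((cmul (continuous_cl_star sF2.continuous).continuousOn
      (cmul hcn sG2.continuous.continuousOn)).const_smul s)
  have iJ := integrable_prod_sphereArea_of_continuousOn hfr fin1 null1 cJ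
  have iI₁ := integrable_prod_sphereArea_of_continuousOn hcl fin2 null2 (F := I₁) cI₁.continuousOn
  have iI₂ := integrable_prod_sphereArea_of_continuousOn hcl fin2 null2 (F := I₂) cI₂.continuousOn
  simp only [star_dotProduct_sigmaMatrix_mulVec,
    integral_sphere_star_D1_dotProduct hm hk hf hg, integral_sphere_star_dotProduct_D1 hm hk hf hg,
    ← hs]
  have hstokes : ∀ u, ∫ x, J x u ∂boundaryArea Ω = ∫ x in Ω, (I₁ x u - I₂ x u) := fun u =>
    integral_boundaryArea_sigma_eq hΩ_open hΩ_bdd hΩ_bdry (sF1.left u) (sG1.left u) (sF2.left u)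
      (sG2.left u) s
  have j₁ : Integrable (fun x => ∫ u : Metric.sphere (0 : E m) 1, I₁ x u ∂sphereArea m)
      (volume.restrict Ω) := iI₁.integral_prod_left
  have j₂ : Integrable (fun x => ∫ u : Metric.sphere (0 : E m) 1, I₂ x u ∂sphereArea m)
      (volume.restrict Ω) := iI₂.integral_prod_left
  change ∫ x, ∫ u : Metric.sphere (0 : E m) 1, J x u ∂sphereArea m ∂boundaryArea Ω =
    (∫ x in Ω, ∫ u : Metric.sphere (0 : E m) 1, I₁ x u ∂sphereArea m) -
      ∫ x in Ω, ∫ u : Metric.sphere (0 : E m) 1, I₂ x u ∂sphereArea m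
  -- From here only the integrability facts and `hstokes` matter, so the integrands become opaque.
  clear_value J I₁ I₂
  rw [← integral_sub j₁ j₂]
  have hsub : ∀ x, (∫ u : Metric.sphere (0 : E m) 1, I₁ x u ∂sphereArea m) -
      ∫ u : Metric.sphere (0 : E m) 1, I₂ x u ∂sphereArea m =
      ∫ u : Metric.sphere (0 : E m) 1, (I₁ x u - I₂ x u) ∂sphereArea m := fun x =>
    (integral_sub
      (integrable_sphereArea_of_continuous (cI₁.comp (Continuous.prodMk_right x)))
      (integrable_sphereArea_of_continuous (cI₂.comp (Continuous.prodMk_right x)))).symm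
  have swap₁ := integral_integral_swap
    (f := fun (x : E m) (u : Metric.sphere (0 : E m) 1) => J x u) iJ
  have swap₂ := integral_integral_swap
    (f := fun (x : E m) (u : Metric.sphere (0 : E m) 1) => I₁ x u - I₂ x u) (iI₁.sub iI₂)
  simp only [hsub]
  -- With u as the outer variable, Stokes' theorem at fixed u applies to the inner integrals.
  rw [swap₁, swap₂]
  simp only [hstokes]

end HigherSpin

theorem mainTheorem2 (m k : ℕ) (hm : 1 ≤ m) (hk : 1 ≤ k) (hmk : 4 < m + 2 * k)
    (Ω : Set (HigherSpin.E m)) (hΩ_open : IsOpen Ω) (hΩ_bdd : Bornology.IsBounded Ω)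
    (hΩ_bdry : HigherSpin.HasC1Boundary Ω)
    (f g : HigherSpin.Field m)
    (hf : HigherSpin.IsSmoothHarm k f) (hg : HigherSpin.IsSmoothHarm k g) :
    (∫ x, (∫ u : Metric.sphere (0 : HigherSpin.E m) 1,
        star (HigherSpin.at2 (HigherSpin.almansi k f) x u) ⬝ᵥ
          (HigherSpin.sigmaMatrix k Ω x *ᵥ HigherSpin.at2 (HigherSpin.almansi k g) x u)
        ∂HigherSpin.sphereArea m) ∂HigherSpin.boundaryArea Ω) =
      (∫ x in Ω, ∫ u : Metric.sphere (0 : HigherSpin.E m) 1,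
        star (HigherSpin.at2 (HigherSpin.D1 k (HigherSpin.almansi k f)) x u) ⬝ᵥ
          HigherSpin.at2 (HigherSpin.almansi k g) x u ∂HigherSpin.sphereArea m) -
      ∫ x in Ω, ∫ u : Metric.sphere (0 : HigherSpin.E m) 1,
        star (HigherSpin.at2 (HigherSpin.almansi k f) x u) ⬝ᵥ
          HigherSpin.at2 (HigherSpin.D1 k (HigherSpin.almansi k g)) x u
        ∂HigherSpin.sphereArea m := by
  exact HigherSpin.stokes_D1 m k hm hk Ω hΩ_open hΩ_bdd hΩ_bdry f g hf hg
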